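/- **Setting.** Let $X$ be a second-countable, locally compact Hausdorff space, and let $\kappa:X\times X\to[0,\infty]$ be a symmetric, lower semicontinuous kernel. For positive Radon measures $\mu,\nu$ on $X$ put $$I(\mu,\nu)=\int\kappa\,d(\mu\otimes\nu),\qquad I(\mu)=I(\mu,\mu),\qquad U^\mu(x)=\int\kappa(x,y)\,d\mu(y).$$ Let $\mathcal E^+$ be the cone of positive Radon measures with $I(\mu)<\infty$, and for $A\subset X$ let $\mathcal E^+(A)$ be the set of $\mu\in\mathcal E^+$ for which $X\setminus A$ is $\mu$-negligible, and $\breve{\mathcal E}^+(A)=\{\mu\in\mathcal E^+(A):\mu(X)=1\}$. Assume: * (energy principle) for every signed Radon measure $\mu$ for which $I(\mu)$ is well defined, $I(\mu)\ge0$, and $I(\mu)=0$ only for $\mu=0$; thus $\|\mu\|=\sqrt{I(\mu)}$ is a norm on the space $\mathcal E$ of signed Radon measures of finite energy, and the corresponding topology is called strong; * (consistency principle) $\mathcal E^+$ is strongly complete, and the strong topology on $\mathcal E^+$ is finer than the vague topology (that of pointwise convergence on continuous functions of compact support); * (domination principle) if $\mu\in\mathcal E^+$, $\nu$ is a positive Radon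 measure, and $U^\mu\le U^\nu$ $\mu$-a.e., then $U^\mu\le U^\nu$ on $X$; * (Ugaheri's maximum principle) there is $M\in[1,\infty)$ such that for all $\mu\in\mathcal E^+$ and $c\in(0,\infty)$, $U^\mu\le c$ $\mu$-a.e. implies $U^\mu\le Mc$ on $X$. If one can take $M=1$, one says that Frostman's maximum principle holds. The inner capacity of $A\subset X$ is $c_*(A)=1/\inf I(\mu)$, the infimum being over the positive Radon measures $\mu$ with $\mu(X)=1$ and $X\setminus A$ $\mu$-negligible; for compact $K$ write $c(K)=c_*(K)$. A property holds n.e. on $A$ if the set of $x\in A$ where it fails has inner capacity zero. Let $A\subset X$ be such that $c_*(A)>0$ and $\mathcal E^+(A)$ is strongly closed. Let $\omega\ne0$ be a positive Radon measure such that either $I(\omega)<\infty$, or else $\omega(X)<\infty$, $U^\omega|_K$ is upper semicontinuous for every compact $K\subset A$, and $\sup_AU^\omega<\infty$. Put $f=-U^\omega$. Under these assumptions there is exactly one measure $\omega^A\in\mathcal E^+(A)$ with $U^{\omega^A}=U^\omega$ n.e. on $A$, called the inner balayage of $\omega$ onto $A$. For $Q=A$, or $Q=K\subset A$ compact with $c(K)>0$,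 let $\lambda_{Q,f}$ denote the minimizer of the Gauss functional $I_f(\mu)=\|\mu\|^2+2\int f\,d\mu$ over $\mu\in\breve{\mathcal E}^+(Q)$, and put $c_{Q,f}=\int(U^{\lambda_{Q,f}}+f)\,d\lambda_{Q,f}$. **Theorem.** Assume that $c_*(A)<\infty$, or $\omega^A(X)=1$, or that Frostman's maximum principle holds and $\omega^A(X)>1$. Then the minimizer $\lambda_{A,f}$ and, for every compact $K\subset A$ with $c(K)>0$, the minimizer $\lambda_{K,f}$ exist and are unique. The compact sets $K\subset A$ with $c(K)>0$ form a nonempty family, upward directed by inclusion, and, as $K\uparrow A$ along this family, $$\lambda_{K,f}\to\lambda_{A,f}\quad\text{strongly and vaguely},\qquad\text{and}\qquad c_{K,f}\to c_{A,f}.$$ -/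

import Mathlib

open MeasureTheory Filter Topology TopologicalSpace Set
open scoped ENNReal NNReal CompactlySupported

noncomputable section

namespace InnerGauss

variable {X : Type*} [TopologicalSpace X] [MeasurableSpace X]

/-! A kernel is a function `κ : X → X → ℝ≥0∞`.  A positive Radon measure on the locally compact,
second-countable space `X` is a Borel measure that is finite on compact sets (such a measure is
automatically regular).  A signed Radon measure is a difference `μ - ν` of positive ones. -/

/-- The mutual energy `I(μ, ν) = ∫ κ(x, y) d(μ ⊗ ν)(x, y)` of positive measures. -/
def mutualEnergy (κ : X → X → ℝ≥0∞) (μ ν : Measure X) : ℝ≥0∞ :=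
  ∫⁻ p : X × X, κ p.1 p.2 ∂(μ.prod ν)

/-- The energy `I(μ) = I(μ, μ)`. -/
def energy (κ : X → X → ℝ≥0∞) (μ : Measure X) : ℝ≥0∞ :=
  mutualEnergy κ μ μ

/-- The potential `U^μ(x) = ∫ κ(x, y) dμ(y)`. -/
def potential (κ : X → X → ℝ≥0∞) (μ : Measure X) (x : X) : ℝ≥0∞ :=
  ∫⁻ y, κ x y ∂μ

/-- The cone `𝓔⁺` of positive Radon measures of finite energy. -/
def EPos (κ : X → X → ℝ≥0∞) : Set (Measure X) :=
  {μ | IsFiniteMeasureOnCompacts μ ∧ energy κ μ < ∞}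

/-- The cone `𝓔⁺(A)` of the measures in `𝓔⁺` concentrated on the (arbitrary) set `A`:
the complement of `A` is `μ`-negligible. -/
def EPosOn (κ : X → X → ℝ≥0∞) (A : Set X) : Set (Measure X) :=
  {μ | μ ∈ EPos κ ∧ μ Aᶜ = 0}

/-- The class of the measures in `𝓔⁺(A)` of total mass one. -/
def EPosUnit (κ : X → X → ℝ≥0∞) (A : Set X) : Set (Measure X) :=
  {μ | μ ∈ EPosOn κ A ∧ μ univ = 1}

/-- The energy principle (strict positive definiteness): `I(μ - ν) ≥ 0`, with equality only if
`μ - ν = 0`.  It is enough to consider `μ, ν` of finite energy: a signed measure whose positive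
or negative part has infinite energy has energy `+∞` or no energy at all.  The inequality is
one in `[0, ∞]`, so that it also forces `I(μ, ν) < ∞`. -/
def EnergyPrinciple (κ : X → X → ℝ≥0∞) : Prop :=
  ∀ μ ∈ EPos κ, ∀ ν ∈ EPos κ,
    2 * mutualEnergy κ μ ν ≤ energy κ μ + energy κ ν ∧
    (2 * mutualEnergy κ μ ν = energy κ μ + energy κ ν → μ = ν)

/-- The energy norm `‖μ - ν‖ = (I(μ) - 2 I(μ, ν) + I(ν))^{1/2}`, for `μ, ν ∈ 𝓔⁺`. -/
def strongDist (κ : X → X → ℝ≥0∞) (μ ν : Measure X) : ℝ :=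
  √((energy κ μ).toReal - 2 * (mutualEnergy κ μ ν).toReal + (energy κ ν).toReal)

/-- Strong convergence of a family in `𝓔⁺` along a filter. -/
def StrongTendsto {ι : Type*} (κ : X → X → ℝ≥0∞) (μ : ι → Measure X) (l : Filter ι)
    (μ₀ : Measure X) : Prop :=
  Tendsto (fun i => strongDist κ (μ i) μ₀) l (𝓝 0)

/-- Vague convergence of positive Radon measures along a filter. -/
def VagueTendsto {ι : Type*} (μ : ι → Measure X) (l : Filter ι) (μ₀ : Measure X) : Prop :=
  ∀ φ : C_c(X, ℝ), Tendsto (fun i => ∫ x, φ x ∂(μ i)) l (𝓝 (∫ x, φ x ∂μ₀))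

/-- The consistency principle: the cone `𝓔⁺` is strongly complete, and the strong topology on it
is finer than the vague topology.  As the strong topology is given by a metric, sequences
suffice in both. -/
def ConsistencyPrinciple (κ : X → X → ℝ≥0∞) : Prop :=
  (∀ μ : ℕ → Measure X, (∀ j, μ j ∈ EPos κ) →
    (∀ ε : ℝ, 0 < ε → ∃ N, ∀ m ≥ N, ∀ n ≥ N, strongDist κ (μ m) (μ n) < ε) →
    ∃ μ₀ ∈ EPos κ, StrongTendsto κ μ atTop μ₀) ∧
  (∀ μ : ℕ → Measure X, (∀ j, μ j ∈ EPos κ) → ∀ μ₀ ∈ EPos κ,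
    StrongTendsto κ μ atTop μ₀ → VagueTendsto μ atTop μ₀)

/-- The domination principle. -/
def DominationPrinciple (κ : X → X → ℝ≥0∞) : Prop :=
  ∀ μ ∈ EPos κ, ∀ ν : Measure X, IsFiniteMeasureOnCompacts ν →
    (∀ᵐ x ∂μ, potential κ μ x ≤ potential κ ν x) → ∀ x, potential κ μ x ≤ potential κ ν x

/-- The `M`-Ugaheri maximum principle. -/
def UgaheriPrinciple (κ : X → X → ℝ≥0∞) (M : ℝ≥0) : Prop :=
  ∀ μ ∈ EPos κ, ∀ c : ℝ≥0, 0 < c →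
    (∀ᵐ x ∂μ, potential κ μ x ≤ c) → ∀ x, potential κ μ x ≤ M * c

/-- Frostman's maximum principle. -/
def FrostmanPrinciple (κ : X → X → ℝ≥0∞) : Prop :=
  UgaheriPrinciple κ 1

/-- The standing assumptions on a kernel: it is symmetric, lower semicontinuous, satisfies the
energy and consistency principles (that is, it is perfect), the domination principle, and
Ugaheri's maximum principle with some constant in `[1, ∞)`. -/
structure IsAdmissibleKernel (κ : X → X → ℝ≥0∞) : Prop where
  symm : ∀ x y, κ x y = κ y x
  lsc : LowerSemicontinuous (Function.uncurry κ)
  energyPrinciple : EnergyPrinciple κ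
  consistencyPrinciple : ConsistencyPrinciple κ
  dominationPrinciple : DominationPrinciple κ
  ugaheriPrinciple : ∃ M : ℝ≥0, 1 ≤ M ∧ UgaheriPrinciple κ M

/-- The inner capacity `c_*(A) = 1 / inf I(μ)`, the infimum being over all positive measures of
total mass one concentrated on `A` (with `1/0 = ∞`, `1/∞ = 0`, and `inf ∅ = ∞`). -/
def innerCap (κ : X → X → ℝ≥0∞) (A : Set X) : ℝ≥0∞ :=
  (⨅ μ ∈ {μ : Measure X | μ univ = 1 ∧ μ Aᶜ = 0}, energy κ μ)⁻¹

/-- `P` holds nearly everywhere on `A`: the exceptional set has inner capacity zero. -/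
def NearlyEverywhereOn (κ : X → X → ℝ≥0∞) (A : Set X) (P : X → Prop) : Prop :=
  innerCap κ {x | x ∈ A ∧ ¬ P x} = 0

/-- The cone `𝓔⁺(A)` is strongly closed.  (Sequences suffice, and limits lie in `𝓔⁺` since this
cone is complete.) -/
def StronglyClosedCone (κ : X → X → ℝ≥0∞) (A : Set X) : Prop :=
  ∀ μ : ℕ → Measure X, (∀ j, μ j ∈ EPosOn κ A) → ∀ μ₀ ∈ EPos κ,
    StrongTendsto κ μ atTop μ₀ → μ₀ ∈ EPosOn κ A

/-- The standing assumptions on the nonzero positive Radon measure `ω`: either it has finite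
energy, or it is bounded, its potential is upper semicontinuous on every compact `K ⊆ A`, and
bounded on `A`. -/
structure IsAdmissibleCharge (κ : X → X → ℝ≥0∞) (A : Set X) (ω : Measure X) : Prop where
  radon : IsFiniteMeasureOnCompacts ω
  ne_zero : ω ≠ 0
  finite_energy_or : energy κ ω < ∞ ∨
    (ω univ < ∞ ∧
      (∀ K : Set X, IsCompact K → K ⊆ A → UpperSemicontinuousOn (potential κ ω) K) ∧
      (⨆ x ∈ A, potential κ ω x) < ∞)

/-- `ν` is the inner balayage of `ω` onto `A`: it belongs to `𝓔⁺(A)`, and `U^ν = U^ω` n.e. on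
`A`. -/
def IsInnerBalayage (κ : X → X → ℝ≥0∞) (A : Set X) (ω ν : Measure X) : Prop :=
  ν ∈ EPosOn κ A ∧ NearlyEverywhereOn κ A (fun x => potential κ ν x = potential κ ω x)

/-- The external field `f = -U^ω`.  It is used only under integrals against unit measures
of `𝓔⁺(A)`; for these `U^ω` is integrable, hence finite almost everywhere, so that the value
given to `f` where `U^ω = ∞` does not matter. -/
def extField (κ : X → X → ℝ≥0∞) (ω : Measure X) (x : X) : ℝ :=
  -(potential κ ω x).toReal

/-- The Gauss functional `I_f(μ) = ‖μ‖² + 2 ∫ f dμ`, where `f = -U^ω`. -/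
def gaussFunctional (κ : X → X → ℝ≥0∞) (ω μ : Measure X) : ℝ :=
  (energy κ μ).toReal + 2 * ∫ x, extField κ ω x ∂μ

/-- `lam` solves the inner Gauss variational problem for `A` and `f = -U^ω`: it minimizes `I_f`
over the measures of `𝓔⁺(A)` of total mass one. -/
def IsGaussMinimizer (κ : X → X → ℝ≥0∞) (ω : Measure X) (A : Set X) (lam : Measure X) : Prop :=
  lam ∈ EPosUnit κ A ∧ ∀ μ ∈ EPosUnit κ A, gaussFunctional κ ω lam ≤ gaussFunctional κ ω μ

/-- The weighted potential `U_f^μ = U^μ + f`, where `f = -U^ω`. -/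
def weightedPotential (κ : X → X → ℝ≥0∞) (ω μ : Measure X) (x : X) : ℝ :=
  (potential κ μ x).toReal + extField κ ω x

/-- The integral `∫ U_f^μ dμ`; for the minimizer `μ = λ_{A,f}` this is the inner weighted
equilibrium constant `c_{A,f}`. -/
def equilibriumConstant (κ : X → X → ℝ≥0∞) (ω μ : Measure X) : ℝ :=
  ∫ x, weightedPotential κ ω μ x ∂μ

/-- The compact subsets `K` of `A` with `c(K) > 0`, ordered by inclusion; `K ↑ A` is the filter
`atTop` on this upward directed set. -/
abbrev CompactIn (κ : X → X → ℝ≥0∞) (A : Set X) : Type _ :=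
  {K : Compacts X // (K : Set X) ⊆ A ∧ 0 < innerCap κ (K : Set X)}

end InnerGauss

end

open InnerGauss

set_option linter.unusedSectionVars false

/-! The energy principle makes signed measures of finite energy a pre-Hilbert space, in which the
Gauss problem is a nearest-point problem. Since `U^{ω^A} = U^ω` n.e. on `A`, hence a.e. for every `μ
∈ 𝓔⁺(A)`, one has `I_f(μ) = ‖μ‖² - 2 I(ω^A, μ) = ‖μ - ω^A‖² - ‖ω^A‖²` (`gaussFunctional_eq`). The
parallelogram law (`realEnergy_midpoint`) makes minimizing sequences Cauchy and minimizers unique.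
Strong completeness supplies limits, so existence reduces to strong closedness of the competing
class.

The balayage itself comes from minimizing `‖σ‖² - 2 ∫ U^ω dσ` over a cone (`exists_projection`). For
`I(ω) = ∞` this is done on compact subsets of `A`, with energies bounded through the maximum
principle, and the swept measures are shown to be Cauchy.

Unit measures could only fail to be closed by losing mass at infinity. If `c_*(A) < ∞`, mass far
away costs too much energy (`exists_compactExhaustion_energy_ge`). If `ω^A(X) ≥ 1`, one minimizes
over mass at most one; a minimizer of smaller mass would be free to vary in every direction of the
cone, hence equal to `ω^A`, which is too heavy.

For the convergence, normalized restrictions of `λ_A` to compact sets nearly attain the minimum. So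
does `λ_K` for all large `K`, and the excess of the functional controls the distance to `λ_A`
(`sqDist_le_of_minimizer`). -/

namespace InnerGauss

/-! ### The energy inner product and quadratic minimization -/

section Algebra

variable {X : Type*} [TopologicalSpace X] [T2Space X] [LocallyCompactSpace X]
    [SecondCountableTopology X] [MeasurableSpace X] [BorelSpace X] {κ : X → X → ℝ≥0∞}

/-- The mutual energy as a real number. -/
noncomputable def realEnergy (κ : X → X → ℝ≥0∞) (μ ν : Measure X) : ℝ := (mutualEnergy κ μ ν).toReal

/-- The square of the energy distance. -/
noncomputable def sqDist (κ : X → X → ℝ≥0∞) (μ ν : Measure X) : ℝ :=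
  realEnergy κ μ μ - 2 * realEnergy κ μ ν + realEnergy κ ν ν

theorem strongDist_eq_sqrt (μ ν : Measure X) : strongDist κ μ ν = √(sqDist κ μ ν) := rfl

theorem measurable_potential (hκ : IsAdmissibleKernel κ) (ν : Measure X) [SFinite ν] :
    Measurable (potential κ ν) :=
  hκ.lsc.measurable.lintegral_prod_right'

theorem mutualEnergy_eq_lintegral (hκ : IsAdmissibleKernel κ) (μ ν : Measure X) [SFinite ν] :
    mutualEnergy κ μ ν = ∫⁻ x, potential κ ν x ∂μ :=
  lintegral_prod _ hκ.lsc.measurable.aemeasurable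

theorem lintegral_potential_comm (hκ : IsAdmissibleKernel κ) (μ ν : Measure X)
    [SFinite μ] [SFinite ν] :
    ∫⁻ x, potential κ ν x ∂μ = ∫⁻ x, potential κ μ x ∂ν := by
  unfold potential
  rw [lintegral_lintegral_swap hκ.lsc.measurable.aemeasurable]
  simp_rw [hκ.symm]

theorem mutualEnergy_comm (hκ : IsAdmissibleKernel κ) (μ ν : Measure X)
    [SFinite μ] [SFinite ν] : mutualEnergy κ μ ν = mutualEnergy κ ν μ := by
  rw [mutualEnergy_eq_lintegral hκ, mutualEnergy_eq_lintegral hκ, lintegral_potential_comm hκ]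

theorem mutualEnergy_add_left (hκ : IsAdmissibleKernel κ) (μ₁ μ₂ ν : Measure X) [SFinite ν] :
    mutualEnergy κ (μ₁ + μ₂) ν = mutualEnergy κ μ₁ ν + mutualEnergy κ μ₂ ν := by
  simp only [mutualEnergy_eq_lintegral hκ, lintegral_add_measure]

theorem mutualEnergy_smul_left (hκ : IsAdmissibleKernel κ) (c : ℝ≥0∞) (μ ν : Measure X)
    [SFinite ν] : mutualEnergy κ (c • μ) ν = c * mutualEnergy κ μ ν := by
  simp only [mutualEnergy_eq_lintegral hκ, lintegral_smul_measure, smul_eq_mul]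

theorem mutualEnergy_mono (hκ : IsAdmissibleKernel κ) {μ μ' ν ν' : Measure X}
    [SFinite ν] [SFinite ν'] (hμ : μ ≤ μ') (hν : ν ≤ ν') :
    mutualEnergy κ μ ν ≤ mutualEnergy κ μ' ν' := by
  rw [mutualEnergy_eq_lintegral hκ, mutualEnergy_eq_lintegral hκ]
  exact lintegral_mono' hμ fun x => lintegral_mono' hν le_rfl

theorem isFiniteMeasureOnCompacts_add {μ ν : Measure X} (hμ : IsFiniteMeasureOnCompacts μ)
    (hν : IsFiniteMeasureOnCompacts ν) : IsFiniteMeasureOnCompacts (μ + ν) :=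
  ⟨fun K hK => by
    rw [Measure.add_apply]
    exact ENNReal.add_lt_top.2 ⟨hK.measure_lt_top, hK.measure_lt_top⟩⟩

theorem isFiniteMeasureOnCompacts_of_le {μ ν : Measure X} (h : μ ≤ ν)
    (hν : IsFiniteMeasureOnCompacts ν) : IsFiniteMeasureOnCompacts μ :=
  ⟨fun _ hK => (h _).trans_lt hK.measure_lt_top⟩

theorem mutualEnergy_lt_top (hκ : IsAdmissibleKernel κ) {μ ν : Measure X} (hμ : μ ∈ EPos κ)
    (hν : ν ∈ EPos κ) : mutualEnergy κ μ ν < ∞ := by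
  have h := (hκ.energyPrinciple μ hμ ν hν).1
  have h2 : 2 * mutualEnergy κ μ ν < ∞ := h.trans_lt (ENNReal.add_lt_top.2 ⟨hμ.2, hν.2⟩)
  exact lt_of_le_of_lt (le_mul_of_one_le_left zero_le one_le_two) h2

theorem zero_mem_EPos : (0 : Measure X) ∈ EPos κ :=
  ⟨inferInstance, by simp [energy, mutualEnergy]⟩

theorem EPos_of_le (hκ : IsAdmissibleKernel κ) {μ ν : Measure X} (h : μ ≤ ν)
    (hν : ν ∈ EPos κ) : μ ∈ EPos κ := by
  have := hν.1
  have := isFiniteMeasureOnCompacts_of_le h hν.1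
  exact ⟨this, (mutualEnergy_mono hκ h h).trans_lt hν.2⟩

theorem EPos_smul (hκ : IsAdmissibleKernel κ) {μ : Measure X} (hμ : μ ∈ EPos κ) {c : ℝ≥0∞}
    (hc : c ≠ ∞) : c • μ ∈ EPos κ := by
  have := hμ.1
  have := IsFiniteMeasureOnCompacts.smul μ hc
  refine ⟨this, ?_⟩
  rw [energy, mutualEnergy_smul_left hκ, mutualEnergy_comm hκ, mutualEnergy_smul_left hκ]
  exact ENNReal.mul_lt_top hc.lt_top (ENNReal.mul_lt_top hc.lt_top hμ.2)

theorem EPos_add (hκ : IsAdmissibleKernel κ) {μ ν : Measure X} (hμ : μ ∈ EPos κ)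
    (hν : ν ∈ EPos κ) : μ + ν ∈ EPos κ := by
  have := hμ.1
  have := hν.1
  have := isFiniteMeasureOnCompacts_add hμ.1 hν.1
  refine ⟨this, ?_⟩
  rw [energy, mutualEnergy_add_left hκ, mutualEnergy_comm hκ, mutualEnergy_add_left hκ,
    mutualEnergy_comm hκ ν (μ + ν), mutualEnergy_add_left hκ]
  simp only [ENNReal.add_lt_top]
  exact ⟨⟨hμ.2, mutualEnergy_lt_top hκ hν hμ⟩, mutualEnergy_lt_top hκ hμ hν, hν.2⟩

theorem realEnergy_comm (hκ : IsAdmissibleKernel κ) {μ ν : Measure X} (hμ : μ ∈ EPos κ)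
    (hν : ν ∈ EPos κ) : realEnergy κ μ ν = realEnergy κ ν μ := by
  have := hμ.1
  have := hν.1
  rw [realEnergy, mutualEnergy_comm hκ, realEnergy]

theorem realEnergy_add_left (hκ : IsAdmissibleKernel κ) {μ₁ μ₂ ν : Measure X} (h₁ : μ₁ ∈ EPos κ)
    (h₂ : μ₂ ∈ EPos κ) (hν : ν ∈ EPos κ) :
    realEnergy κ (μ₁ + μ₂) ν = realEnergy κ μ₁ ν + realEnergy κ μ₂ ν := by
  have := hν.1
  rw [realEnergy, mutualEnergy_add_left hκ, ENNReal.toReal_add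
    (mutualEnergy_lt_top hκ h₁ hν).ne (mutualEnergy_lt_top hκ h₂ hν).ne]
  rfl

theorem realEnergy_add_right (hκ : IsAdmissibleKernel κ) {μ₁ μ₂ ν : Measure X} (h₁ : μ₁ ∈ EPos κ)
    (h₂ : μ₂ ∈ EPos κ) (hν : ν ∈ EPos κ) :
    realEnergy κ ν (μ₁ + μ₂) = realEnergy κ ν μ₁ + realEnergy κ ν μ₂ := by
  rw [realEnergy_comm hκ hν (EPos_add hκ h₁ h₂), realEnergy_add_left hκ h₁ h₂ hν,
    realEnergy_comm hκ hν h₁, realEnergy_comm hκ hν h₂]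

theorem realEnergy_smul_left (hκ : IsAdmissibleKernel κ) {t : ℝ} (ht : 0 ≤ t) {μ ν : Measure X}
    (hν : ν ∈ EPos κ) :
    realEnergy κ (ENNReal.ofReal t • μ) ν = t * realEnergy κ μ ν := by
  have := hν.1
  rw [realEnergy, mutualEnergy_smul_left hκ, ENNReal.toReal_mul, ENNReal.toReal_ofReal ht]
  rfl

theorem realEnergy_smul_right (hκ : IsAdmissibleKernel κ) {t : ℝ} (ht : 0 ≤ t) {μ ν : Measure X}
    (hμ : μ ∈ EPos κ) (hν : ν ∈ EPos κ) :
    realEnergy κ ν (ENNReal.ofReal t • μ) = t * realEnergy κ ν μ := by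
  rw [realEnergy_comm hκ hν (EPos_smul hκ hμ ENNReal.ofReal_ne_top),
    realEnergy_smul_left hκ ht hν, realEnergy_comm hκ hν hμ]

theorem realEnergy_nonneg (μ ν : Measure X) : 0 ≤ realEnergy κ μ ν := ENNReal.toReal_nonneg

theorem sqDist_nonneg (hκ : IsAdmissibleKernel κ) {μ ν : Measure X} (hμ : μ ∈ EPos κ)
    (hν : ν ∈ EPos κ) : 0 ≤ sqDist κ μ ν := by
  have h := ENNReal.toReal_mono (ENNReal.add_lt_top.2 ⟨hμ.2, hν.2⟩).ne
    (hκ.energyPrinciple μ hμ ν hν).1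
  rw [ENNReal.toReal_mul, ENNReal.toReal_add hμ.2.ne hν.2.ne, ENNReal.toReal_ofNat] at h
  unfold sqDist realEnergy
  unfold energy at h
  linarith

theorem eq_of_sqDist_le_zero (hκ : IsAdmissibleKernel κ) {μ ν : Measure X} (hμ : μ ∈ EPos κ)
    (hν : ν ∈ EPos κ) (h : sqDist κ μ ν ≤ 0) : μ = ν := by
  have h0 := le_antisymm h (sqDist_nonneg hκ hμ hν)
  refine (hκ.energyPrinciple μ hμ ν hν).2 ?_
  rw [← ENNReal.toReal_eq_toReal_iff'
    (ENNReal.mul_ne_top ENNReal.ofNat_ne_top (mutualEnergy_lt_top hκ hμ hν).ne)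
    (ENNReal.add_lt_top.2 ⟨hμ.2, hν.2⟩).ne, ENNReal.toReal_mul,
    ENNReal.toReal_add hμ.2.ne hν.2.ne, ENNReal.toReal_ofNat]
  unfold sqDist realEnergy at h0
  unfold energy
  linarith

theorem sqDist_comm (hκ : IsAdmissibleKernel κ) {μ ν : Measure X} (hμ : μ ∈ EPos κ)
    (hν : ν ∈ EPos κ) : sqDist κ μ ν = sqDist κ ν μ := by
  unfold sqDist
  rw [realEnergy_comm hκ hμ hν]
  ring

/-- The Cauchy–Schwarz inequality for the difference of two measures against a third one. -/
theorem sq_realEnergy_sub_le (hκ : IsAdmissibleKernel κ) {σ μ ν : Measure X} (hσ : σ ∈ EPos κ)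
    (hμ : μ ∈ EPos κ) (hν : ν ∈ EPos κ) :
    (realEnergy κ σ μ - realEnergy κ σ ν) ^ 2 ≤ realEnergy κ σ σ * sqDist κ μ ν := by
  -- This is `‖μ + tσ - ν‖² ≥ 0`. Only nonnegative multiples of `σ` are measures; negative `t` is
  -- reached by exchanging `μ` and `ν`.
  have key : ∀ t : ℝ, 0 ≤ t → ∀ {μ ν : Measure X}, μ ∈ EPos κ → ν ∈ EPos κ →
      0 ≤ realEnergy κ σ σ * (t * t) + 2 * (realEnergy κ σ μ - realEnergy κ σ ν) * t
        + sqDist κ μ ν := by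
    intro t ht μ ν hμ hν
    have hs : ENNReal.ofReal t • σ ∈ EPos κ := EPos_smul hκ hσ ENNReal.ofReal_ne_top
    have hs' := EPos_add hκ hμ hs
    have h := sqDist_nonneg hκ hs' hν
    unfold sqDist at h ⊢
    rw [realEnergy_add_left hκ hμ hs hs', realEnergy_add_right hκ hμ hs hμ,
      realEnergy_add_right hκ hμ hs hs, realEnergy_add_left hκ hμ hs hν,
      realEnergy_smul_left hκ ht hμ, realEnergy_smul_left hκ ht hν, realEnergy_smul_left hκ ht hs,
      realEnergy_smul_right hκ ht hσ hμ, realEnergy_smul_right hκ ht hσ hσ,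
      realEnergy_comm hκ hμ hσ] at h
    linarith
  have hd := discrim_le_zero (a := realEnergy κ σ σ)
    (b := 2 * (realEnergy κ σ μ - realEnergy κ σ ν)) (c := sqDist κ μ ν) (fun t => by
      rcases le_total 0 t with ht | ht
      · exact key t ht hμ hν
      · have := key (-t) (by linarith) hν hμ
        rw [sqDist_comm hκ hν hμ] at this
        linarith)
  unfold discrim at hd
  linarith

theorem abs_realEnergy_sub_le (hκ : IsAdmissibleKernel κ) {σ μ ν : Measure X} (hσ : σ ∈ EPos κ)
    (hμ : μ ∈ EPos κ) (hν : ν ∈ EPos κ) :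
    |realEnergy κ σ μ - realEnergy κ σ ν| ≤ √(realEnergy κ σ σ) * strongDist κ μ ν := by
  rw [strongDist_eq_sqrt, ← Real.sqrt_mul (realEnergy_nonneg _ _)]
  exact Real.abs_le_sqrt (sq_realEnergy_sub_le hκ hσ hμ hν)

variable {ι : Type*} {l : Filter ι} {μ : ι → Measure X} {μ₀ : Measure X}

theorem strongTendsto_iff_sqDist (hκ : IsAdmissibleKernel κ) (hμ : ∀ i, μ i ∈ EPos κ)
    (h₀ : μ₀ ∈ EPos κ) :
    StrongTendsto κ μ l μ₀ ↔ Tendsto (fun i => sqDist κ (μ i) μ₀) l (𝓝 0) := by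
  unfold StrongTendsto
  constructor
  · intro h
    have := h.pow 2
    simpa [strongDist_eq_sqrt, Real.sq_sqrt (sqDist_nonneg hκ (hμ _) h₀)] using this
  · intro h
    simpa [strongDist_eq_sqrt] using h.sqrt

theorem StrongTendsto.realEnergy_left (hκ : IsAdmissibleKernel κ) (hμ : ∀ i, μ i ∈ EPos κ)
    (h₀ : μ₀ ∈ EPos κ) (h : StrongTendsto κ μ l μ₀) {σ : Measure X} (hσ : σ ∈ EPos κ) :
    Tendsto (fun i => realEnergy κ σ (μ i)) l (𝓝 (realEnergy κ σ μ₀)) := by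
  rw [tendsto_iff_dist_tendsto_zero]
  refine squeeze_zero (fun _ => dist_nonneg)
    (fun i => abs_realEnergy_sub_le hκ hσ (hμ i) h₀) ?_
  simpa using Tendsto.const_mul (√(realEnergy κ σ σ)) h

theorem StrongTendsto.realEnergy_self (hκ : IsAdmissibleKernel κ) (hμ : ∀ i, μ i ∈ EPos κ)
    (h₀ : μ₀ ∈ EPos κ) (h : StrongTendsto κ μ l μ₀) :
    Tendsto (fun i => realEnergy κ (μ i) (μ i)) l (𝓝 (realEnergy κ μ₀ μ₀)) := by
  have h1 := (strongTendsto_iff_sqDist hκ hμ h₀).1 h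
  have h2 := StrongTendsto.realEnergy_left hκ hμ h₀ h h₀
  have h3 := (h1.add (h2.const_mul 2)).sub_const (realEnergy κ μ₀ μ₀)
  refine (h3.congr fun i => ?_).trans (by ring_nf; exact le_rfl)
  unfold sqDist
  rw [realEnergy_comm hκ (hμ i) h₀]
  ring

/-- A sequence of measures in `𝓔⁺` that is Cauchy for the energy distance converges strongly. -/
theorem exists_strongTendsto (hκ : IsAdmissibleKernel κ) {μ : ℕ → Measure X}
    (hμ : ∀ j, μ j ∈ EPos κ) {b : ℕ → ℝ} (hb : Tendsto b atTop (𝓝 0))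
    (h : ∀ m n, m ≤ n → sqDist κ (μ m) (μ n) ≤ b m) :
    ∃ μ₀ ∈ EPos κ, StrongTendsto κ μ atTop μ₀ := by
  refine hκ.consistencyPrinciple.1 μ hμ fun ε hε => ?_
  obtain ⟨N, hN⟩ := eventually_atTop.1 (hb.eventually (gt_mem_nhds (by positivity : 0 < ε ^ 2)))
  refine ⟨N, fun m hm n hn => ?_⟩
  rw [strongDist_eq_sqrt, Real.sqrt_lt' hε]
  rcases le_total m n with hmn | hmn
  · exact (h m n hmn).trans_lt (hN m hm)
  · rw [sqDist_comm hκ (hμ m) (hμ n)]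
    exact (h n m hmn).trans_lt (hN n hn)

/-- The midpoint of two measures. -/
noncomputable def midpointMeasure (μ ν : Measure X) : Measure X := ENNReal.ofReal (1 / 2) • (μ + ν)

theorem midpointMeasure_mem_EPos (hκ : IsAdmissibleKernel κ) {μ ν : Measure X}
    (hμ : μ ∈ EPos κ) (hν : ν ∈ EPos κ) : midpointMeasure μ ν ∈ EPos κ :=
  EPos_smul hκ (EPos_add hκ hμ hν) ENNReal.ofReal_ne_top

/-- The parallelogram law. The gain of a quarter of the squared distance is what gives Cauchy
minimizing sequences, uniqueness, and control of the distance to a minimizer. -/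
theorem realEnergy_midpoint (hκ : IsAdmissibleKernel κ) {μ ν : Measure X}
    (hμ : μ ∈ EPos κ) (hν : ν ∈ EPos κ) :
    realEnergy κ (midpointMeasure μ ν) (midpointMeasure μ ν) =
      realEnergy κ μ μ / 2 + realEnergy κ ν ν / 2 - sqDist κ μ ν / 4 := by
  have h := EPos_add hκ hμ hν
  have hm := midpointMeasure_mem_EPos hκ hμ hν
  unfold midpointMeasure at hm ⊢
  rw [realEnergy_smul_left hκ (by norm_num) hm,
    realEnergy_smul_right hκ (by norm_num) h h, realEnergy_add_left hκ hμ hν h,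
    realEnergy_add_right hκ hμ hν hμ, realEnergy_add_right hκ hμ hν hν, sqDist,
    realEnergy_comm hκ hν hμ]
  ring

/-- Minimization of a quadratic functional over a midpoint convex, strongly closed set. -/
theorem exists_minimizer (hκ : IsAdmissibleKernel κ) {S : Set (Measure X)} (hS : S ⊆ EPos κ)
    (hne : S.Nonempty) (hmid : ∀ μ ∈ S, ∀ ν ∈ S, midpointMeasure μ ν ∈ S)
    (hclosed : ∀ μ : ℕ → Measure X, (∀ j, μ j ∈ S) → ∀ μ₀ ∈ EPos κ,
      StrongTendsto κ μ atTop μ₀ → μ₀ ∈ S)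
    (L : Measure X → ℝ)
    (hLmid : ∀ μ ∈ S, ∀ ν ∈ S, L (midpointMeasure μ ν) = (L μ + L ν) / 2)
    (hLcont : ∀ μ : ℕ → Measure X, (∀ j, μ j ∈ S) → ∀ μ₀ ∈ S,
      StrongTendsto κ μ atTop μ₀ → Tendsto (fun j => L (μ j)) atTop (𝓝 (L μ₀)))
    (hbdd : ∃ c : ℝ, ∀ μ ∈ S, c ≤ realEnergy κ μ μ - 2 * L μ) :
    ∃ ν ∈ S, ∀ μ ∈ S, realEnergy κ ν ν - 2 * L ν ≤ realEnergy κ μ μ - 2 * L μ := by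
  set J : Measure X → ℝ := fun μ => realEnergy κ μ μ - 2 * L μ with hJ
  have hbb : BddBelow (J '' S) := by
    obtain ⟨c, hc⟩ := hbdd
    exact ⟨c, by rintro _ ⟨μ, hμ, rfl⟩; exact hc μ hμ⟩
  set d := sInf (J '' S) with hd
  have hdle : ∀ μ ∈ S, d ≤ J μ := fun μ hμ => csInf_le hbb ⟨μ, hμ, rfl⟩
  have hseq : ∀ n : ℕ, ∃ μ ∈ S, J μ < d + 1 / ((n : ℝ) + 1) := fun n => by
    obtain ⟨_, ⟨μ, hμ, rfl⟩, h⟩ := exists_lt_of_csInf_lt (hne.image J)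
      (lt_add_of_pos_right d (Nat.one_div_pos_of_nat (n := n) (α := ℝ)))
    exact ⟨μ, hμ, h⟩
  choose μ hμS hμJ using hseq
  have hlim := tendsto_one_div_add_atTop_nhds_zero_nat (𝕜 := ℝ)
  -- The midpoint has `J ≥ d`, so the squared distance is below `2/(m+1) + 2/(n+1)`, which is at
  -- most `4/(m+1)` for `m ≤ n`.
  obtain ⟨ν, hν, hlimν⟩ := exists_strongTendsto hκ (fun j => hS (hμS j))
    (b := fun n => 4 * (1 / ((n : ℝ) + 1))) (by simpa using hlim.const_mul 4) (by
      intro m n hmn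
      have h1 := hdle _ (hmid _ (hμS m) _ (hμS n))
      have h2 := hμJ m
      have h3 := hμJ n
      have h4 : 1 / ((n : ℝ) + 1) ≤ 1 / ((m : ℝ) + 1) := Nat.one_div_le_one_div hmn
      simp only [hJ] at h1 h2 h3
      rw [realEnergy_midpoint hκ (hS (hμS m)) (hS (hμS n)), hLmid _ (hμS m) _ (hμS n)] at h1
      linarith)
  have hνS := hclosed μ hμS ν hν hlimν
  refine ⟨ν, hνS, fun σ hσ => ?_⟩
  have hJlim : Tendsto (fun n => J (μ n)) atTop (𝓝 (J ν)) :=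
    (StrongTendsto.realEnergy_self hκ (fun j => hS (hμS j)) hν hlimν).sub
      ((hLcont μ hμS ν hνS hlimν).const_mul 2)
  have : J ν ≤ d := le_of_tendsto_of_tendsto hJlim
    (by simpa using hlim.const_add d) (Eventually.of_forall fun n => (hμJ n).le)
  exact this.trans (hdle σ hσ)

theorem minimizer_unique (hκ : IsAdmissibleKernel κ) {S : Set (Measure X)} (hS : S ⊆ EPos κ)
    (hmid : ∀ μ ∈ S, ∀ ν ∈ S, midpointMeasure μ ν ∈ S) (L : Measure X → ℝ)
    (hLmid : ∀ μ ∈ S, ∀ ν ∈ S, L (midpointMeasure μ ν) = (L μ + L ν) / 2)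
    {ν ν' : Measure X} (hν : ν ∈ S)
    (hmin : ∀ μ ∈ S, realEnergy κ ν ν - 2 * L ν ≤ realEnergy κ μ μ - 2 * L μ)
    (hν' : ν' ∈ S)
    (hmin' : ∀ μ ∈ S, realEnergy κ ν' ν' - 2 * L ν' ≤ realEnergy κ μ μ - 2 * L μ) :
    ν = ν' := by
  have h1 := hmin _ (hmid _ hν _ hν')
  have h2 := hmin' _ hν
  rw [realEnergy_midpoint hκ (hS hν) (hS hν'), hLmid _ hν _ hν'] at h1
  exact eq_of_sqDist_le_zero hκ (hS hν) (hS hν') (by linarith)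

end Algebra

end InnerGauss

namespace InnerGauss

/-! ### Measures concentrated on a set, and inner capacity -/

section Concentrated

variable {X : Type*} [TopologicalSpace X] [T2Space X] [LocallyCompactSpace X]
    [SecondCountableTopology X] [MeasurableSpace X] [BorelSpace X] {κ : X → X → ℝ≥0∞}
    {A B : Set X} {μ ν μ₀ : Measure X}

theorem EPosOn_mono (h : A ⊆ B) : EPosOn κ A ⊆ EPosOn κ B := fun _ hμ =>
  ⟨hμ.1, measure_mono_null (compl_subset_compl.2 h) hμ.2⟩

theorem EPosUnit_mono (h : A ⊆ B) : EPosUnit κ A ⊆ EPosUnit κ B := fun _ hμ =>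
  ⟨EPosOn_mono h hμ.1, hμ.2⟩

theorem zero_mem_EPosOn : (0 : Measure X) ∈ EPosOn κ A := ⟨zero_mem_EPos, by simp⟩

theorem EPosOn_of_le (hκ : IsAdmissibleKernel κ) (h : μ ≤ ν) (hν : ν ∈ EPosOn κ A) :
    μ ∈ EPosOn κ A :=
  ⟨EPos_of_le hκ h hν.1, le_antisymm ((h _).trans_eq hν.2) zero_le⟩

theorem EPosOn_smul (hκ : IsAdmissibleKernel κ) (hμ : μ ∈ EPosOn κ A) {c : ℝ≥0∞} (hc : c ≠ ∞) :
    c • μ ∈ EPosOn κ A :=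
  ⟨EPos_smul hκ hμ.1 hc, by simp [hμ.2]⟩

theorem EPosOn_add (hκ : IsAdmissibleKernel κ) (hμ : μ ∈ EPosOn κ A) (hν : ν ∈ EPosOn κ A) :
    μ + ν ∈ EPosOn κ A :=
  ⟨EPos_add hκ hμ.1 hν.1, by simp [hμ.2, hν.2]⟩

theorem midpointMeasure_mem_EPosOn (hκ : IsAdmissibleKernel κ) (hμ : μ ∈ EPosOn κ A)
    (hν : ν ∈ EPosOn κ A) : midpointMeasure μ ν ∈ EPosOn κ A :=
  EPosOn_smul hκ (EPosOn_add hκ hμ hν) ENNReal.ofReal_ne_top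

theorem midpointMeasure_univ_le (hμ : μ univ ≤ 1) (hν : ν univ ≤ 1) :
    midpointMeasure μ ν univ ≤ 1 := by
  rw [midpointMeasure, Measure.smul_apply, Measure.add_apply, smul_eq_mul]
  calc ENNReal.ofReal (1 / 2) * (μ univ + ν univ) ≤ ENNReal.ofReal (1 / 2) * (1 + 1) := by gcongr
    _ = ENNReal.ofReal (1 / 2) * ENNReal.ofReal 2 := by norm_num
    _ = 1 := by rw [← ENNReal.ofReal_mul (by norm_num)]; norm_num

theorem midpointMeasure_mem_EPosUnit (hκ : IsAdmissibleKernel κ) (hμ : μ ∈ EPosUnit κ A)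
    (hν : ν ∈ EPosUnit κ A) : midpointMeasure μ ν ∈ EPosUnit κ A := by
  refine ⟨midpointMeasure_mem_EPosOn hκ hμ.1 hν.1, ?_⟩
  rw [midpointMeasure, Measure.smul_apply, Measure.add_apply, smul_eq_mul, hμ.2, hν.2]
  calc ENNReal.ofReal (1 / 2) * (1 + 1)
      = ENNReal.ofReal (1 / 2) * ENNReal.ofReal 2 := by norm_num
    _ = 1 := by rw [← ENNReal.ofReal_mul (by norm_num)]; norm_num

theorem normalize_mem_EPosUnit (hκ : IsAdmissibleKernel κ) (hμ : μ ∈ EPosOn κ A)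
    (h0 : μ univ ≠ 0) (hfin : μ univ ≠ ∞) : (μ univ)⁻¹ • μ ∈ EPosUnit κ A :=
  ⟨EPosOn_smul hκ hμ (ENNReal.inv_ne_top.2 h0), by
    rw [Measure.smul_apply, smul_eq_mul, ENNReal.inv_mul_cancel h0 hfin]⟩

theorem innerCap_pos_iff : 0 < innerCap κ A ↔ (EPosUnit κ A).Nonempty := by
  rw [innerCap, ENNReal.inv_pos, ← lt_top_iff_ne_top]
  simp only [iInf_lt_iff]
  constructor
  · rintro ⟨μ, ⟨h1, h2⟩, h3⟩
    have : IsFiniteMeasure μ := ⟨by rw [h1]; exact ENNReal.one_lt_top⟩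
    exact ⟨μ, ⟨⟨inferInstance, h3⟩, h2⟩, h1⟩
  · rintro ⟨μ, ⟨⟨_, h3⟩, h2⟩, h1⟩
    exact ⟨μ, ⟨h1, h2⟩, h3⟩

theorem innerCap_mono (h : A ⊆ B) : innerCap κ A ≤ innerCap κ B := by
  refine ENNReal.inv_le_inv.2 (biInf_mono fun μ hμ => ⟨hμ.1, ?_⟩)
  exact measure_mono_null (compl_subset_compl.2 h) hμ.2

/-- If the inner capacity of `A` is finite, the energies of unit measures on `A` are bounded
away from zero. -/
theorem exists_lower_bound_of_innerCap_lt_top (h : innerCap κ A < ∞) :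
    ∃ w : ℝ, 0 < w ∧ ∀ μ ∈ EPosUnit κ A, w ≤ realEnergy κ μ μ := by
  rw [innerCap, lt_top_iff_ne_top, ENNReal.inv_ne_top, ← pos_iff_ne_zero] at h
  obtain ⟨w, hw0, hw⟩ := ENNReal.lt_iff_exists_nnreal_btwn.1 h
  refine ⟨w, by exact_mod_cast hw0, fun μ hμ => ?_⟩
  have h1 : (w : ℝ≥0∞) ≤ energy κ μ := hw.le.trans (biInf_le _ ⟨hμ.2, hμ.1.2⟩)
  exact ENNReal.toReal_mono hμ.1.1.2.ne h1

/-- Energy is homogeneous of degree two, so a bound for unit measures extends to every finite mass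
by normalization. -/
theorem mass_sq_mul_le (hκ : IsAdmissibleKernel κ) {w : ℝ}
    (hw : ∀ μ ∈ EPosUnit κ A, w ≤ realEnergy κ μ μ) (hμ : μ ∈ EPosOn κ A) (hfin : μ univ ≠ ∞) :
    w * μ.real univ ^ 2 ≤ realEnergy κ μ μ := by
  rcases eq_or_ne (μ univ) 0 with h0 | h0
  · simp [measureReal_def, h0, realEnergy_nonneg]
  have hm : 0 < μ.real univ := ENNReal.toReal_pos h0 hfin
  have h := hw _ (normalize_mem_EPosUnit hκ hμ h0 hfin)
  have he : (μ univ)⁻¹ = ENNReal.ofReal (μ.real univ)⁻¹ := by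
    rw [ENNReal.ofReal_inv_of_pos hm, measureReal_def, ENNReal.ofReal_toReal hfin]
  have hi : 0 ≤ (μ.real univ)⁻¹ := by positivity
  rw [he, realEnergy_smul_left hκ hi (EPos_smul hκ hμ.1 ENNReal.ofReal_ne_top),
    realEnergy_smul_right hκ hi hμ.1 hμ.1] at h
  have h2 := mul_le_mul_of_nonneg_right h (sq_nonneg (μ.real univ))
  refine h2.trans_eq ?_
  field_simp

/-- A property that holds n.e. on `A` holds almost everywhere for each measure in `𝓔⁺(A)`. -/
theorem NearlyEverywhereOn.ae (hκ : IsAdmissibleKernel κ) {P : X → Prop}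
    (h : NearlyEverywhereOn κ A P) (hP : MeasurableSet {x | P x}) (hμ : μ ∈ EPosOn κ A) :
    ∀ᵐ x ∂μ, P x := by
  have := hμ.1.1
  rw [ae_iff]
  by_contra hne
  let T := {x | P x}ᶜ
  -- Cutting the exceptional set by a compact set makes the restricted mass finite. Its
  -- normalization is then a unit measure of finite energy on a set of capacity zero, which is
  -- impossible.
  obtain ⟨n, hn⟩ : ∃ n, μ (T ∩ compactCovering X n) ≠ 0 := by
    by_contra! hall
    refine hne ?_
    have hT : {x | ¬ P x} = ⋃ n, T ∩ compactCovering X n := by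
      rw [← inter_iUnion, iUnion_compactCovering, inter_univ]; rfl
    rw [hT]
    exact measure_iUnion_null hall
  let S := T ∩ compactCovering X n
  have hSm : MeasurableSet S := hP.compl.inter (isCompact_compactCovering X n).measurableSet
  have hSfin : μ S ≠ ∞ :=
    ((measure_mono inter_subset_right).trans_lt
      (isCompact_compactCovering X n).measure_lt_top).ne
  have h1 := EPosOn_of_le hκ (Measure.restrict_le_self (s := S)) hμ
  have h2 : μ.restrict S ∈ EPosOn κ {x | x ∈ A ∧ ¬ P x} := by
    refine ⟨h1.1, ?_⟩
    have hsub : {x | x ∈ A ∧ ¬ P x}ᶜ ⊆ Aᶜ ∪ Sᶜ := by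
      intro x hx
      by_cases hxA : x ∈ A
      · exact Or.inr fun hxS => hx ⟨hxA, hxS.1⟩
      · exact Or.inl hxA
    refine measure_mono_null hsub (measure_union_null h1.2 ?_)
    rw [Measure.restrict_apply hSm.compl]
    simp
  have h3 := normalize_mem_EPosUnit hκ h2 (by simpa [S] using hn) (by simpa using hSfin)
  exact (innerCap_pos_iff.2 ⟨_, h3⟩).ne' h

/-- If a property fails to hold n.e. on `A`, then it fails almost everywhere for some unit measure
of finite energy concentrated on `A`. -/
theorem exists_of_not_nearlyEverywhereOn {P : X → Prop} (h : ¬ NearlyEverywhereOn κ A P) :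
    ∃ μ ∈ EPosUnit κ A, ∀ᵐ x ∂μ, ¬ P x := by
  obtain ⟨μ, hμ⟩ := innerCap_pos_iff.1 (pos_iff_ne_zero.2 h)
  refine ⟨μ, EPosUnit_mono (fun x hx => hx.1) hμ, ?_⟩
  filter_upwards [mem_ae_iff.2 hμ.1.2] with x hx using hx.2

/-- A finite measure concentrated on `A` is carried by compact subsets of `A`, up to `ε`. -/
theorem exists_isCompact_measure_compl_lt [IsFiniteMeasure μ] (hμ : μ Aᶜ = 0) {ε : ℝ≥0∞}
    (hε : ε ≠ 0) : ∃ K ⊆ A, IsCompact K ∧ μ Kᶜ < ε := by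
  -- `A` need not be measurable: inner regularity is applied to the complement of a measurable null
  -- hull of `Aᶜ`.
  have hT : μ (toMeasurable μ Aᶜ) = 0 := by rw [measure_toMeasurable, hμ]
  obtain ⟨K, hK, hKc, hKε⟩ := (measurableSet_toMeasurable μ Aᶜ).compl.exists_isCompact_sdiff_lt
    (measure_ne_top μ _) hε
  refine ⟨K, hK.trans (compl_subset_comm.1 (subset_toMeasurable μ Aᶜ)), hKc, ?_⟩
  have hsub : Kᶜ ⊆ ((toMeasurable μ Aᶜ)ᶜ \ K) ∪ toMeasurable μ Aᶜ := by
    intro x hx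
    by_cases hxT : x ∈ toMeasurable μ Aᶜ
    · exact Or.inr hxT
    · exact Or.inl ⟨hxT, hx⟩
  calc μ Kᶜ ≤ μ ((toMeasurable μ Aᶜ)ᶜ \ K) + μ (toMeasurable μ Aᶜ) :=
        (measure_mono hsub).trans (measure_union_le _ _)
    _ < ε := by rwa [hT, add_zero]

end Concentrated

/-! ### Vague limits: supports and total mass -/

section Vague

variable {X : Type*} [TopologicalSpace X] [T2Space X] [LocallyCompactSpace X]
    [SecondCountableTopology X] [MeasurableSpace X] [BorelSpace X] {κ : X → X → ℝ≥0∞}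

/-- Strong convergence implies vague convergence, along every filter. -/
theorem StrongTendsto.vagueTendsto (hκ : IsAdmissibleKernel κ) {ι : Type*} {l : Filter ι}
    {μ : ι → Measure X} {μ₀ : Measure X} (hμ : ∀ i, μ i ∈ EPos κ) (h₀ : μ₀ ∈ EPos κ)
    (h : StrongTendsto κ μ l μ₀) : VagueTendsto μ l μ₀ := by
  intro φ
  rw [Metric.tendsto_nhds]
  intro ε hε
  by_contra hne
  -- The consistency principle concerns sequences. A failure along `l` is frequent while closeness
  -- to `μ₀` is eventual, so a sequence of counterexamples converging strongly can be selected.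
  have hfreq : ∃ᶠ i in l, ε ≤ dist (∫ x, φ x ∂(μ i)) (∫ x, φ x ∂μ₀) := by
    simpa [Filter.not_eventually] using hne
  have hseq : ∀ n : ℕ, ∃ i, ε ≤ dist (∫ x, φ x ∂(μ i)) (∫ x, φ x ∂μ₀) ∧
      strongDist κ (μ i) μ₀ < 1 / ((n : ℝ) + 1) := fun n =>
    (hfreq.and_eventually (h.eventually (gt_mem_nhds Nat.one_div_pos_of_nat))).exists
  choose i hi hi' using hseq
  have hs : StrongTendsto κ (fun n => μ (i n)) atTop μ₀ :=
    squeeze_zero (fun _ => Real.sqrt_nonneg _) (fun n => (hi' n).le)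
      tendsto_one_div_add_atTop_nhds_zero_nat
  have hv := hκ.consistencyPrinciple.2 _ (fun n => hμ (i n)) μ₀ h₀ hs φ
  obtain ⟨n, hn⟩ := ((Metric.tendsto_nhds.1 hv) ε hε).exists
  exact (hi n).not_gt hn

/-- Continuous cutoff functions. -/
theorem exists_cutoff {K U : Set X} (hK : IsCompact K) (hU : IsOpen U) (hKU : K ⊆ U) :
    ∃ φ : C_c(X, ℝ), (∀ x ∈ K, φ x = 1) ∧ (∀ x ∉ U, φ x = 0) ∧ (∀ x, 0 ≤ φ x) ∧
      ∀ x, φ x ≤ 1 := by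
  obtain ⟨f, h1, h2, h3, h4⟩ := exists_continuous_one_zero_of_isCompact hK hU.isClosed_compl
    (disjoint_compl_right_iff_subset.2 hKU)
  exact ⟨⟨f, h3⟩, fun x hx => h1 hx, fun x hx => h2 hx, fun x => (h4 x).1, fun x => (h4 x).2⟩

theorem integrable_compactlySupported (φ : C_c(X, ℝ)) (μ : Measure X)
    [IsFiniteMeasureOnCompacts μ] : Integrable φ μ :=
  φ.continuous.integrable_of_hasCompactSupport φ.hasCompactSupport

theorem measureReal_le_integral {μ : Measure X} [IsFiniteMeasureOnCompacts μ] {K : Set X}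
    (hK : IsCompact K) {φ : C_c(X, ℝ)} (h1 : ∀ x ∈ K, φ x = 1) (h0 : ∀ x, 0 ≤ φ x) :
    μ.real K ≤ ∫ x, φ x ∂μ := by
  have hi : IntegrableOn (fun _ => (1 : ℝ)) K μ := integrableOn_const hK.measure_lt_top.ne
  calc μ.real K = ∫ x in K, (1 : ℝ) ∂μ := by simp
    _ = ∫ x in K, φ x ∂μ := (setIntegral_congr_fun hK.measurableSet fun x hx => h1 x hx).symm
    _ ≤ ∫ x, φ x ∂μ := setIntegral_le_integral (integrable_compactlySupported φ μ)
        (Eventually.of_forall h0)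

theorem integral_le_measureReal {μ : Measure X} [IsFiniteMeasure μ] {φ : C_c(X, ℝ)}
    (h1 : ∀ x, φ x ≤ 1) : ∫ x, φ x ∂μ ≤ μ.real univ := by
  calc ∫ x, φ x ∂μ ≤ ∫ _, (1 : ℝ) ∂μ :=
        integral_mono (integrable_compactlySupported φ μ) (integrable_const _) h1
    _ = μ.real univ := by simp

theorem measure_le_of_forall_isCompact_le {μ : Measure X} [IsFiniteMeasureOnCompacts μ] {U : Set X}
    (hU : IsOpen U) {c : ℝ≥0∞} (h : ∀ K ⊆ U, IsCompact K → μ K ≤ c) : μ U ≤ c := by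
  rw [hU.measure_eq_iSup_isCompact]
  exact iSup_le fun K => iSup_le fun hKU => iSup_le fun hK => h K hKU hK

theorem VagueTendsto.measure_eq_zero {μ : ℕ → Measure X} {μ₀ : Measure X}
    (h₀ : IsFiniteMeasureOnCompacts μ₀)
    (h : VagueTendsto μ atTop μ₀) {U : Set X} (hU : IsOpen U)
    (h0 : ∀ K ⊆ U, IsCompact K → ∀ᶠ j in atTop, μ j (interior K) = 0) : μ₀ U = 0 := by
  refine le_antisymm (measure_le_of_forall_isCompact_le hU fun K hKU hK => ?_) zero_le
  obtain ⟨L, hL, hKL, hLU⟩ := exists_compact_between hK hU hKU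
  obtain ⟨φ, h1, h2, h3, -⟩ := exists_cutoff hK isOpen_interior hKL
  have hlim : Tendsto (fun j => ∫ x, φ x ∂(μ j)) atTop (𝓝 0) := by
    refine tendsto_const_nhds.congr' ?_
    filter_upwards [h0 L hLU hL] with j hj
    refine (integral_eq_zero_of_ae ?_).symm
    filter_upwards [measure_eq_zero_iff_ae_notMem.1 hj] with x hx using h2 x hx
  have hz := tendsto_nhds_unique (h φ) hlim
  have hle := measureReal_le_integral (μ := μ₀) hK h1 h3
  rw [hz] at hle
  have := le_antisymm hle measureReal_nonneg
  rw [measureReal_eq_zero_iff hK.measure_lt_top.ne] at this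
  exact this.le

/-- Vague limits may lose mass but cannot gain any, as testing against cutoffs of compact sets
shows. -/
theorem VagueTendsto.measure_univ_le {μ : ℕ → Measure X} {μ₀ : Measure X}
    (h₀ : IsFiniteMeasureOnCompacts μ₀) (h : VagueTendsto μ atTop μ₀)
    (hμ : ∀ j, μ j univ ≤ 1) : μ₀ univ ≤ 1 := by
  refine measure_le_of_forall_isCompact_le isOpen_univ fun K _ hK => ?_
  obtain ⟨φ, h1, -, h3, h4⟩ := exists_cutoff hK isOpen_univ (subset_univ K)
  have hle := measureReal_le_integral (μ := μ₀) hK h1 h3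
  have h5 : ∫ x, φ x ∂μ₀ ≤ 1 := by
    refine le_of_tendsto (h φ) (Eventually.of_forall fun j => ?_)
    have : IsFiniteMeasure (μ j) := ⟨(hμ j).trans_lt ENNReal.one_lt_top⟩
    refine (integral_le_measureReal h4).trans ?_
    simpa [measureReal_def] using ENNReal.toReal_mono ENNReal.one_ne_top (hμ j)
  rw [← ENNReal.toReal_le_toReal hK.measure_lt_top.ne ENNReal.one_ne_top, ENNReal.toReal_one]
  exact hle.trans h5

/-- Mass that stays in a fixed compact set survives in the limit. -/
theorem VagueTendsto.le_measure_univ {μ : ℕ → Measure X} {μ₀ : Measure X}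
    (h₀ : IsFiniteMeasure μ₀) (h : VagueTendsto μ atTop μ₀)
    (hμ : ∀ j, IsFiniteMeasure (μ j)) {K : Set X} (hK : IsCompact K) {c : ℝ}
    (hc : ∀ j, c ≤ (μ j).real K) : c ≤ μ₀.real univ := by
  obtain ⟨φ, h1, -, h3, h4⟩ := exists_cutoff hK isOpen_univ (subset_univ K)
  exact (ge_of_tendsto (h φ) (Eventually.of_forall fun j =>
    (hc j).trans (measureReal_le_integral hK h1 h3))).trans (integral_le_measureReal h4)

/-- The cone `𝓔⁺(K)` is strongly closed for compact `K`. -/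
theorem stronglyClosedCone_of_isCompact (hκ : IsAdmissibleKernel κ) {K : Set X}
    (hK : IsCompact K) : StronglyClosedCone κ K := by
  intro μ hμ μ₀ h₀ h
  refine ⟨h₀, ?_⟩
  refine VagueTendsto.measure_eq_zero h₀.1
    (StrongTendsto.vagueTendsto hκ (fun j => (hμ j).1) h₀ h) hK.isClosed.isOpen_compl
    fun L hL _ => Eventually.of_forall fun j =>
      measure_mono_null (interior_subset.trans hL) (hμ j).2

/-- A function whose restriction to a compact set `K` is continuous and finite has a vaguely
continuous integral on measures concentrated on `K`. -/
theorem VagueTendsto.lintegral_of_continuousOn {K : Set X} (hK : IsCompact K) {g : X → ℝ≥0∞}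
    (hg : ContinuousOn g K) (hfin : ∀ x ∈ K, g x ≠ ∞) (hgm : Measurable g)
    {μ : ℕ → Measure X} {μ₀ : Measure X} (hμ : ∀ j, μ j Kᶜ = 0) (hμ₀ : μ₀ Kᶜ = 0)
    (h : VagueTendsto μ atTop μ₀) :
    Tendsto (fun j => (∫⁻ x, g x ∂(μ j)).toReal) atTop (𝓝 (∫⁻ x, g x ∂μ₀).toReal) := by
  have hg' : ContinuousOn (fun x => (g x).toReal) K := fun x hx =>
    (ENNReal.continuousAt_toReal (hfin x hx)).comp_continuousWithinAt (hg x hx)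
  -- Tietze's extension of `g` from `K`, times a cutoff equal to one on `K`, is an admissible test
  -- function with the same integrals.
  obtain ⟨G, hG⟩ := ContinuousMap.exists_restrict_eq (Y := ℝ) hK.isClosed ⟨_, hg'.domRestrict⟩
  have hGK : ∀ x ∈ K, G x = (g x).toReal := fun x hx => DFunLike.congr_fun hG ⟨x, hx⟩
  obtain ⟨φ, h1, -, -, -⟩ := exists_cutoff hK isOpen_univ (subset_univ K)
  let ψ : C_c(X, ℝ) := ⟨⟨fun x => φ x * G x, by fun_prop⟩, φ.hasCompactSupport.mul_right⟩
  have hint : ∀ ν : Measure X, ν Kᶜ = 0 → ∫ x, ψ x ∂ν = (∫⁻ x, g x ∂ν).toReal := by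
    intro ν hν
    have hae : ∀ᵐ x ∂ν, x ∈ K := mem_ae_iff.2 hν
    rw [← integral_toReal hgm.aemeasurable (hae.mono fun x hx => (hfin x hx).lt_top)]
    refine integral_congr_ae (hae.mono fun x hx => ?_)
    change φ x * G x = _
    rw [h1 x hx, one_mul, hGK x hx]
  have := h ψ
  simpa only [hint _ (hμ _), hint _ hμ₀] using this

end Vague

end InnerGauss

namespace InnerGauss

/-! ### Lower semicontinuous potentials and capacity of compact sets -/

section Capacity

variable {X : Type*} [TopologicalSpace X] [T2Space X] [LocallyCompactSpace X]
    [SecondCountableTopology X] [MeasurableSpace X] [BorelSpace X] {κ : X → X → ℝ≥0∞}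
    {A : Set X}

/-- Fatou's lemma along the countably generated filter `𝓝 x`. -/
theorem lowerSemicontinuous_potential (hκ : IsAdmissibleKernel κ) (ν : Measure X) :
    LowerSemicontinuous (potential κ ν) := by
  rw [lowerSemicontinuous_iff_le_liminf]
  intro x
  refine le_trans (lintegral_mono fun y => ?_)
    (lintegral_liminf_le (μ := ν) (u := 𝓝 x) (f := fun z y => κ z y) fun z =>
      hκ.lsc.measurable.comp measurable_prodMk_left)
  exact lowerSemicontinuousAt_iff_le_liminf.1
    ((hκ.lsc.comp (by fun_prop : Continuous fun z : X => (z, y))) x)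

/-- Otherwise the Dirac measure at `x` would be a nonzero measure of zero energy. -/
theorem kernel_diag_ne_zero (hκ : IsAdmissibleKernel κ) (x : X) : κ x x ≠ 0 := by
  intro h0
  have he : energy κ (Measure.dirac x) = 0 := by
    rw [energy, mutualEnergy_eq_lintegral hκ, lintegral_dirac, potential, lintegral_dirac, h0]
  have hd : Measure.dirac x ∈ EPos κ := ⟨inferInstance, by rw [he]; exact ENNReal.zero_lt_top⟩
  have h := (hκ.energyPrinciple _ hd 0 zero_mem_EPos).2
    (by rw [he]; simp [energy, mutualEnergy])
  have := congrArg (fun μ : Measure X => μ univ) h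
  simp at this

/-- Compact sets have finite inner capacity. -/
theorem innerCap_lt_top_of_isCompact (hκ : IsAdmissibleKernel κ) {K : Set X} (hK : IsCompact K) :
    innerCap κ K < ∞ := by
  -- Compactness induction: near `(x, x)` the kernel exceeds a positive constant `c`, so `c μ(t)² ≤
  -- I(μ)` for some neighbourhood `t` of `x`, and such bounds survive unions.
  obtain ⟨C, hC⟩ : ∃ C : ℝ≥0, ∀ μ : Measure X, SFinite μ → μ K ^ 2 ≤ C * energy κ μ := by
    refine hK.induction_on (p := fun s => ∃ C : ℝ≥0, ∀ μ : Measure X, SFinite μ →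
      μ s ^ 2 ≤ C * energy κ μ) ⟨0, by simp⟩ ?_ ?_ ?_
    · rintro s t hst ⟨C, hC⟩
      exact ⟨C, fun μ hμ => (pow_le_pow_left' (measure_mono hst) 2).trans (hC μ hμ)⟩
    · rintro s t ⟨C, hC⟩ ⟨D, hD⟩
      refine ⟨4 * max C D, fun μ hμ => ?_⟩
      have h1 : μ (s ∪ t) ≤ 2 * max (μ s) (μ t) := by
        refine (measure_union_le s t).trans ?_
        rw [two_mul]
        exact add_le_add (le_max_left _ _) (le_max_right _ _)
      calc μ (s ∪ t) ^ 2 ≤ (2 * max (μ s) (μ t)) ^ 2 := pow_le_pow_left' h1 2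
        _ = 4 * max (μ s) (μ t) ^ 2 := by rw [mul_pow]; norm_num
        _ ≤ 4 * (max C D * energy κ μ) := by
            gcongr
            rcases le_total (μ s) (μ t) with h | h
            · rw [max_eq_right h]
              exact (hD μ hμ).trans (by gcongr; exact le_max_right _ _)
            · rw [max_eq_left h]
              exact (hC μ hμ).trans (by gcongr; exact le_max_left _ _)
        _ = (4 * max C D : ℝ≥0) * energy κ μ := by push_cast; rw [mul_assoc]
    · intro x _
      obtain ⟨c, hc0, hc⟩ := ENNReal.lt_iff_exists_nnreal_btwn.1
        (pos_iff_ne_zero.2 (kernel_diag_ne_zero hκ x))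
      have hc0 : c ≠ 0 := by rintro rfl; exact lt_irrefl _ hc0
      have hev : ∀ᶠ p in 𝓝 x ×ˢ 𝓝 x, (c : ℝ≥0∞) < κ p.1 p.2 := by
        rw [← nhds_prod_eq]
        exact hκ.lsc (x, x) c hc
      obtain ⟨t, ht, htc⟩ := mem_prod_self_iff.1 hev
      refine ⟨t, mem_nhdsWithin_of_mem_nhds ht, c⁻¹, fun μ hμ => ?_⟩
      have h1 : c * μ t ^ 2 ≤ energy κ μ := by
        calc c * μ t ^ 2 = ∫⁻ _ in t ×ˢ t, (c : ℝ≥0∞) ∂(μ.prod μ) := by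
              rw [setLIntegral_const, Measure.prod_prod, sq]
          _ ≤ ∫⁻ p in t ×ˢ t, κ p.1 p.2 ∂(μ.prod μ) := by
              refine setLIntegral_mono hκ.lsc.measurable fun p hp => ?_
              exact (htc hp : (c : ℝ≥0∞) < κ p.1 p.2).le
          _ ≤ energy κ μ := setLIntegral_le_lintegral _ _
      rw [ENNReal.coe_inv hc0, mul_comm, ← div_eq_mul_inv,
        ENNReal.le_div_iff_mul_le (Or.inl (by exact_mod_cast hc0)) (Or.inl ENNReal.coe_ne_top),
        mul_comm]
      exact h1
  rw [innerCap, lt_top_iff_ne_top, ENNReal.inv_ne_top]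
  intro h0
  -- `C` may vanish, hence the `C + 1`.
  have hlt : ⨅ μ ∈ {μ : Measure X | μ univ = 1 ∧ μ Kᶜ = 0}, energy κ μ < ((C + 1 : ℝ≥0) : ℝ≥0∞)⁻¹ := by
    rw [h0, ENNReal.inv_pos]
    exact ENNReal.coe_ne_top
  simp only [iInf_lt_iff] at hlt
  obtain ⟨μ, ⟨h1, h2⟩, h3⟩ := hlt
  have : IsFiniteMeasure μ := ⟨by rw [h1]; exact ENNReal.one_lt_top⟩
  have hμK : μ K = 1 := by
    rw [← h1]
    exact measure_congr (eventuallyEq_univ.2 (mem_ae_iff.2 h2))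
  have h4 := hC μ inferInstance
  rw [hμK, one_pow] at h4
  have h5 : (C : ℝ≥0∞) * energy κ μ < 1 := by
    calc (C : ℝ≥0∞) * energy κ μ ≤ (C + 1 : ℝ≥0) * energy κ μ := by gcongr; simp
      _ < (C + 1 : ℝ≥0) * ((C + 1 : ℝ≥0) : ℝ≥0∞)⁻¹ := by
          refine (ENNReal.mul_lt_mul_iff_right ?_ ENNReal.coe_ne_top).2 h3
          exact_mod_cast (by positivity : (C + 1 : ℝ≥0) ≠ 0)
      _ = 1 := ENNReal.mul_inv_cancel (by exact_mod_cast (by positivity : (C + 1 : ℝ≥0) ≠ 0))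
          ENNReal.coe_ne_top
  exact absurd h4 h5.not_ge

end Capacity

/-! ### Variational construction of dominating potentials -/

section Projection

variable {X : Type*} [TopologicalSpace X] [T2Space X] [LocallyCompactSpace X]
    [SecondCountableTopology X] [MeasurableSpace X] [BorelSpace X] {κ : X → X → ℝ≥0∞}
    {A Q : Set X}

theorem nonneg_of_quadratic_nonneg {a b δ : ℝ} (hδ : 0 < δ)
    (h : ∀ t, 0 < t → t < δ → 0 ≤ 2 * t * a + t ^ 2 * b) : 0 ≤ a := by
  have hlim : Tendsto (fun t : ℝ => 2 * a + t * b) (𝓝[>] 0) (𝓝 (2 * a)) := by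
    have : Continuous fun t : ℝ => 2 * a + t * b := by fun_prop
    simpa using (this.tendsto 0).mono_left nhdsWithin_le_nhds
  have : 0 ≤ 2 * a := by
    refine ge_of_tendsto hlim ?_
    filter_upwards [Ioo_mem_nhdsGT hδ] with t ht
    have := h t ht.1 ht.2
    have h2 : 0 ≤ t * (2 * a + t * b) := by linarith
    exact nonneg_of_mul_nonneg_right h2 ht.1
  linarith

/-- First variation in the direction of a positive measure. -/
theorem le_realEnergy_of_variation (hκ : IsAdmissibleKernel κ) {ν σ : Measure X}
    (hν : ν ∈ EPos κ) (hσ : σ ∈ EPos κ) {a b δ : ℝ} (hδ : 0 < δ)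
    (h : ∀ t, 0 < t → t < δ → realEnergy κ ν ν - 2 * a ≤
      realEnergy κ (ν + ENNReal.ofReal t • σ) (ν + ENNReal.ofReal t • σ) - 2 * (a + t * b)) :
    b ≤ realEnergy κ ν σ := by
  have := nonneg_of_quadratic_nonneg (a := realEnergy κ ν σ - b) (b := realEnergy κ σ σ) hδ
    fun t ht htδ => by
      have hs : ENNReal.ofReal t • σ ∈ EPos κ := EPos_smul hκ hσ ENNReal.ofReal_ne_top
      have hνs := EPos_add hκ hν hs
      have h1 := h t ht htδ
      rw [realEnergy_add_left hκ hν hs hνs, realEnergy_add_right hκ hν hs hν,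
        realEnergy_add_right hκ hν hs hs, realEnergy_smul_left hκ ht.le hν,
        realEnergy_smul_left hκ ht.le hs, realEnergy_smul_right hκ ht.le hσ hν,
        realEnergy_smul_right hκ ht.le hσ hσ, realEnergy_comm hκ hσ hν] at h1
      linarith
  linarith

/-- First variation under shrinking. -/
theorem realEnergy_le_of_variation (hκ : IsAdmissibleKernel κ) {ν : Measure X}
    (hν : ν ∈ EPos κ) {a : ℝ}
    (h : ∀ t, 0 < t → t < 1 → realEnergy κ ν ν - 2 * a ≤
      realEnergy κ (ENNReal.ofReal (1 - t) • ν) (ENNReal.ofReal (1 - t) • ν) -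
        2 * ((1 - t) * a)) :
    realEnergy κ ν ν ≤ a := by
  have := nonneg_of_quadratic_nonneg (a := a - realEnergy κ ν ν) (b := realEnergy κ ν ν) one_pos
    fun t ht ht1 => by
      have h1 := h t ht ht1
      have h2 : 0 ≤ 1 - t := by linarith
      rw [realEnergy_smul_left hκ h2 (EPos_smul hκ hν ENNReal.ofReal_ne_top),
        realEnergy_smul_right hκ h2 hν hν] at h1
      linarith
  linarith

theorem toReal_lintegral_add_smul {g : X → ℝ≥0∞} {ν σ : Measure X} (hν : ∫⁻ x, g x ∂ν < ∞)
    (hσ : ∫⁻ x, g x ∂σ < ∞) {t : ℝ} (ht : 0 ≤ t) :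
    (∫⁻ x, g x ∂(ν + ENNReal.ofReal t • σ)).toReal =
      (∫⁻ x, g x ∂ν).toReal + t * (∫⁻ x, g x ∂σ).toReal := by
  rw [lintegral_add_measure, lintegral_smul_measure, smul_eq_mul, ENNReal.toReal_add hν.ne
    (ENNReal.mul_lt_top ENNReal.ofReal_lt_top hσ).ne, ENNReal.toReal_mul,
    ENNReal.toReal_ofReal ht]

theorem toReal_lintegral_smul {g : X → ℝ≥0∞} {ν : Measure X} {t : ℝ} (ht : 0 ≤ t) :
    (∫⁻ x, g x ∂(ENNReal.ofReal t • ν)).toReal = t * (∫⁻ x, g x ∂ν).toReal := by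
  rw [lintegral_smul_measure, smul_eq_mul, ENNReal.toReal_mul, ENNReal.toReal_ofReal ht]

theorem toReal_lintegral_midpoint {g : X → ℝ≥0∞} {μ ν : Measure X} (hμ : ∫⁻ x, g x ∂μ < ∞)
    (hν : ∫⁻ x, g x ∂ν < ∞) :
    (∫⁻ x, g x ∂(midpointMeasure μ ν)).toReal =
      ((∫⁻ x, g x ∂μ).toReal + (∫⁻ x, g x ∂ν).toReal) / 2 := by
  rw [midpointMeasure, toReal_lintegral_smul (by norm_num), lintegral_add_measure,
    ENNReal.toReal_add hμ.ne hν.ne]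
  ring

/-- The measure in `𝓔⁺(Q)` whose potential dominates `g` n.e. on `Q`, with equality almost
everywhere with respect to the measure itself. -/
theorem exists_projection (hκ : IsAdmissibleKernel κ) (hQ : StronglyClosedCone κ Q)
    {g : X → ℝ≥0∞} (hg : Measurable g) (hfin : ∀ σ ∈ EPosOn κ Q, ∫⁻ x, g x ∂σ < ∞)
    (hcont : ∀ μ : ℕ → Measure X, (∀ j, μ j ∈ EPosOn κ Q) → ∀ μ₀ ∈ EPosOn κ Q,
      StrongTendsto κ μ atTop μ₀ →
        Tendsto (fun j => (∫⁻ x, g x ∂(μ j)).toReal) atTop (𝓝 (∫⁻ x, g x ∂μ₀).toReal))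
    (hbdd : ∃ c : ℝ, ∀ σ ∈ EPosOn κ Q, c ≤ realEnergy κ σ σ - 2 * (∫⁻ x, g x ∂σ).toReal) :
    ∃ ν ∈ EPosOn κ Q, NearlyEverywhereOn κ Q (fun x => g x ≤ potential κ ν x) ∧
      ∀ᵐ x ∂ν, g x = potential κ ν x := by
  obtain ⟨ν, hν, hmin⟩ := exists_minimizer hκ (S := EPosOn κ Q) (fun _ h => h.1)
    ⟨0, zero_mem_EPosOn⟩ (fun _ hμ _ hν => midpointMeasure_mem_EPosOn hκ hμ hν) hQ
    (fun σ => (∫⁻ x, g x ∂σ).toReal)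
    (fun μ hμ ν hν => toReal_lintegral_midpoint (hfin μ hμ) (hfin ν hν)) hcont hbdd
  have := hν.1.1
  have hpm := measurable_potential hκ ν
  -- Adding a small multiple of `σ` to the minimizer gives `∫ g dσ ≤ ∫ U^ν dσ`; shrinking the
  -- minimizer gives the reverse inequality for `σ = ν`.
  have hge : ∀ σ ∈ EPosOn κ Q, ∫⁻ x, g x ∂σ ≤ ∫⁻ x, potential κ ν x ∂σ := fun σ hσ => by
    have := hσ.1.1
    rw [← mutualEnergy_eq_lintegral hκ, mutualEnergy_comm hκ,
      ← ENNReal.toReal_le_toReal (hfin σ hσ).ne (mutualEnergy_lt_top hκ hν.1 hσ.1).ne]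
    refine le_realEnergy_of_variation hκ hν.1 hσ.1 one_pos
      (a := (∫⁻ x, g x ∂ν).toReal) fun t ht _ => ?_
    rw [← toReal_lintegral_add_smul (hfin ν hν) (hfin σ hσ) ht.le]
    exact hmin _ (EPosOn_add hκ hν (EPosOn_smul hκ hσ ENNReal.ofReal_ne_top))
  have hle : ∫⁻ x, potential κ ν x ∂ν ≤ ∫⁻ x, g x ∂ν := by
    rw [← mutualEnergy_eq_lintegral hκ,
      ← ENNReal.toReal_le_toReal (mutualEnergy_lt_top hκ hν.1 hν.1).ne (hfin ν hν).ne]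
    refine realEnergy_le_of_variation hκ hν.1 fun t ht ht1 => ?_
    rw [← toReal_lintegral_smul (t := 1 - t) (by linarith)]
    exact hmin _ (EPosOn_smul hκ hν ENNReal.ofReal_ne_top)
  have hne : NearlyEverywhereOn κ Q (fun x => g x ≤ potential κ ν x) := by
    by_contra hn
    obtain ⟨σ, hσ, hlt⟩ := exists_of_not_nearlyEverywhereOn hn
    have hσ0 : σ ≠ 0 := by
      rintro rfl
      exact zero_ne_one hσ.2
    have hσfin : ∫⁻ x, potential κ ν x ∂σ ≠ ∞ := by
      rw [← mutualEnergy_eq_lintegral hκ]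
      exact (mutualEnergy_lt_top hκ hσ.1.1 hν.1).ne
    exact (lintegral_strict_mono hσ0 hg.aemeasurable hσfin
      (hlt.mono fun x hx => not_le.1 hx)).not_ge (hge σ hσ.1)
  refine ⟨ν, hν, hne, ?_⟩
  exact ae_eq_of_ae_le_of_lintegral_le (hne.ae hκ (measurableSet_le hg hpm) hν) (hfin ν hν).ne
    hpm.aemeasurable hle

theorem measure_univ_ne_top_of_isCompact {K : Set X} (hK : IsCompact K) {σ : Measure X}
    (hσ : σ ∈ EPosOn κ K) : σ univ ≠ ∞ := by
  have := hσ.1.1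
  rw [← union_compl_self K]
  exact ((measure_union_le _ _).trans_lt
    (by rw [hσ.2, add_zero]; exact hK.measure_lt_top)).ne

/-- On a compact set, continuity of `g` gives vague, hence strong, continuity of the linear term;
finite capacity bounds the functional below. -/
theorem exists_projection_of_isCompact (hκ : IsAdmissibleKernel κ) {K : Set X}
    (hK : IsCompact K) {g : X → ℝ≥0∞} (hg : Measurable g) (hgc : ContinuousOn g K) {C : ℝ≥0}
    (hgC : ∀ x ∈ K, g x ≤ C) :
    ∃ ν ∈ EPosOn κ K, NearlyEverywhereOn κ K (fun x => g x ≤ potential κ ν x) ∧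
      ∀ᵐ x ∂ν, g x = potential κ ν x := by
  have hbound : ∀ σ ∈ EPosOn κ K, ∫⁻ x, g x ∂σ ≤ C * σ univ := fun σ hσ => by
    rw [← lintegral_const]
    exact lintegral_mono_ae (Filter.mem_of_superset (mem_ae_iff.2 hσ.2 : K ∈ ae σ) hgC)
  have hfin : ∀ σ ∈ EPosOn κ K, ∫⁻ x, g x ∂σ < ∞ := fun σ hσ => (hbound σ hσ).trans_lt
    (ENNReal.mul_lt_top ENNReal.coe_lt_top (measure_univ_ne_top_of_isCompact hK hσ).lt_top)
  refine exists_projection hκ (stronglyClosedCone_of_isCompact hκ hK) hg hfin ?_ ?_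
  · intro μ hμ μ₀ hμ₀ h
    exact VagueTendsto.lintegral_of_continuousOn hK hgc
      (fun x hx => ((hgC x hx).trans_lt ENNReal.coe_lt_top).ne) hg (fun j => (hμ j).2) hμ₀.2
      (StrongTendsto.vagueTendsto hκ (fun j => (hμ j).1) hμ₀.1 h)
  · obtain ⟨w, hw0, hw⟩ := exists_lower_bound_of_innerCap_lt_top
      (innerCap_lt_top_of_isCompact hκ hK)
    -- For mass `m` the functional is at least `w m² - 2 C m`, whose minimum, at `m = C / w`, is
    -- `-C²/w`.
    refine ⟨-(C ^ 2 / w), fun σ hσ => ?_⟩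
    have hm := measure_univ_ne_top_of_isCompact hK hσ
    have h1 := mass_sq_mul_le hκ hw hσ hm
    have h2 : (∫⁻ x, g x ∂σ).toReal ≤ C * σ.real univ := by
      have := ENNReal.toReal_mono (ENNReal.mul_ne_top ENNReal.coe_ne_top hm) (hbound σ hσ)
      rwa [ENNReal.toReal_mul, ENNReal.coe_toReal] at this
    have h3 : w * σ.real univ ^ 2 - 2 * (C * σ.real univ) + C ^ 2 / w
        = w * (σ.real univ - C / w) ^ 2 := by
      field_simp
      ring
    have h4 : 0 ≤ w * (σ.real univ - C / w) ^ 2 := by positivity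
    linarith

/-- For `g = U^ω`, the projection is the inner balayage. -/
theorem isInnerBalayage_of_projection (hκ : IsAdmissibleKernel κ) {ω ν : Measure X}
    (hω : IsFiniteMeasureOnCompacts ω) (hν : ν ∈ EPosOn κ Q)
    (hne : NearlyEverywhereOn κ Q (fun x => potential κ ω x ≤ potential κ ν x))
    (hae : ∀ᵐ x ∂ν, potential κ ω x = potential κ ν x) :
    IsInnerBalayage κ Q ω ν ∧ ∀ x, potential κ ν x ≤ potential κ ω x := by
  have hle := hκ.dominationPrinciple ν hν.1 ω hω (hae.mono fun x hx => hx.ge)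
  refine ⟨⟨hν, ?_⟩, hle⟩
  have : {x | x ∈ Q ∧ ¬ potential κ ν x = potential κ ω x} =
      {x | x ∈ Q ∧ ¬ potential κ ω x ≤ potential κ ν x} := by
    ext x
    simp only [mem_ofPred_eq, (hle x).ge_iff_eq']
    tauto
  unfold NearlyEverywhereOn at hne ⊢
  rwa [this]

end Projection

end InnerGauss

namespace InnerGauss

/-! ### Existence and uniqueness of the inner balayage -/

section Balayage

variable {X : Type*} [TopologicalSpace X] [T2Space X] [LocallyCompactSpace X]
    [SecondCountableTopology X] [MeasurableSpace X] [BorelSpace X] {κ : X → X → ℝ≥0∞}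
    {A : Set X} {ω : Measure X}

theorem IsInnerBalayage.ae_eq (hκ : IsAdmissibleKernel κ) (hω : IsFiniteMeasureOnCompacts ω)
    {ν : Measure X} (h : IsInnerBalayage κ A ω ν) {μ : Measure X} (hμ : μ ∈ EPosOn κ A) :
    potential κ ν =ᵐ[μ] potential κ ω := by
  have := h.1.1.1
  exact NearlyEverywhereOn.ae hκ h.2
    (measurableSet_eq_fun (measurable_potential hκ ν) (measurable_potential hκ ω)) hμ

/-- This replaces `ω`, possibly of infinite energy, by an element of `𝓔⁺`, and so makes the external
field a linear functional of Hilbert type. -/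
theorem IsInnerBalayage.lintegral_eq (hκ : IsAdmissibleKernel κ)
    (hω : IsFiniteMeasureOnCompacts ω) {ν : Measure X} (h : IsInnerBalayage κ A ω ν)
    {μ : Measure X} (hμ : μ ∈ EPosOn κ A) : ∫⁻ x, potential κ ω x ∂μ = mutualEnergy κ μ ν := by
  have := h.1.1.1
  rw [mutualEnergy_eq_lintegral hκ]
  exact (lintegral_congr_ae (h.ae_eq hκ hω hμ)).symm

theorem IsInnerBalayage.unique (hκ : IsAdmissibleKernel κ) (hω : IsFiniteMeasureOnCompacts ω)
    {ν ν' : Measure X} (h : IsInnerBalayage κ A ω ν) (h' : IsInnerBalayage κ A ω ν') :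
    ν = ν' := by
  have key : ∀ {μ : Measure X}, μ ∈ EPosOn κ A → realEnergy κ μ ν = realEnergy κ μ ν' :=
    fun hμ => by rw [realEnergy, ← h.lintegral_eq hκ hω hμ, h'.lintegral_eq hκ hω hμ, realEnergy]
  refine eq_of_sqDist_le_zero hκ h.1.1 h'.1.1 (le_of_eq ?_)
  have h1 := key h.1
  have h2 := key h'.1
  rw [realEnergy_comm hκ h'.1.1 h.1.1] at h2
  unfold sqDist
  linarith

/-- Here the functional is `‖σ - ω‖² - ‖ω‖²`, so the balayage is the nearest point to `ω` in the
cone. -/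
theorem exists_balayage_of_energy_lt_top (hκ : IsAdmissibleKernel κ)
    (hA : StronglyClosedCone κ A) (hω : ω ∈ EPos κ) : ∃ ν, IsInnerBalayage κ A ω ν := by
  have := hω.1
  have hL : ∀ σ : Measure X, (∫⁻ x, potential κ ω x ∂σ).toReal = realEnergy κ σ ω := fun σ => by
    rw [← mutualEnergy_eq_lintegral hκ, realEnergy]
  obtain ⟨ν, hν, hne, hae⟩ := exists_projection hκ hA (measurable_potential hκ ω)
    (fun σ hσ => by
      rw [← mutualEnergy_eq_lintegral hκ]
      exact mutualEnergy_lt_top hκ hσ.1 hω)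
    (fun μ hμ μ₀ hμ₀ h => by
      simp only [hL]
      rw [realEnergy_comm hκ hμ₀.1 hω]
      simp only [realEnergy_comm hκ (hμ _).1 hω]
      exact StrongTendsto.realEnergy_left hκ (fun j => (hμ j).1) hμ₀.1 h hω)
    ⟨-realEnergy κ ω ω, fun σ hσ => by
      have := sqDist_nonneg hκ hσ.1 hω
      unfold sqDist at this
      rw [hL]
      linarith⟩
  exact ⟨ν, (isInnerBalayage_of_projection hκ hω.1 hν hne hae).1⟩

/-- Balayage onto a compact set on which the potential of a bounded measure is continuous
and bounded, with an energy estimate. -/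
theorem exists_balayage_of_isCompact (hκ : IsAdmissibleKernel κ) [IsFiniteMeasure ω]
    {M : ℝ≥0} (hM : UgaheriPrinciple κ M) {K : Set X} (hK : IsCompact K)
    (husc : UpperSemicontinuousOn (potential κ ω) K) {C : ℝ≥0}
    (hC : ∀ x ∈ K, potential κ ω x ≤ C) :
    ∃ ν, IsInnerBalayage κ K ω ν ∧ energy κ ν ≤ C * (M * ω univ) := by
  obtain ⟨ν, hν, hne, hae⟩ := exists_projection_of_isCompact hκ hK (measurable_potential hκ ω)
    (continuousOn_iff_lower_upperSemicontinuousOn.2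
      ⟨(lowerSemicontinuous_potential hκ ω).lowerSemicontinuousOn K, husc⟩) hC
  obtain ⟨hbal, hle⟩ := isInnerBalayage_of_projection hκ inferInstance hν hne hae
  refine ⟨ν, hbal, ?_⟩
  -- `γ` is the equilibrium measure of `K`: its potential is at least 1 n.e. on `K` and, by
  -- Ugaheri's principle, at most `M` everywhere. Integrating it against `ν` and `ω` gives `ν(X) ≤ M
  -- ω(X)`.
  obtain ⟨γ, hγ, hγne, hγae⟩ := exists_projection_of_isCompact hκ hK (g := fun _ => 1)
    measurable_const continuousOn_const (C := 1) (by simp)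
  have := hν.1.1
  have := hγ.1.1
  have hγM : ∀ x, potential κ γ x ≤ M := by
    simpa using hM γ hγ.1 1 one_pos (hγae.mono fun x hx => by simp [← hx])
  have hmass : ν univ ≤ M * ω univ := by
    calc ν univ = ∫⁻ _, 1 ∂ν := by simp
      _ ≤ ∫⁻ x, potential κ γ x ∂ν := lintegral_mono_ae
          (hγne.ae hκ (measurableSet_le measurable_const (measurable_potential hκ γ)) hν)
      _ = ∫⁻ x, potential κ ν x ∂γ := lintegral_potential_comm hκ _ _
      _ ≤ ∫⁻ x, potential κ ω x ∂γ := lintegral_mono hle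
      _ = ∫⁻ x, potential κ γ x ∂ω := lintegral_potential_comm hκ _ _
      _ ≤ ∫⁻ _, M ∂ω := lintegral_mono hγM
      _ = M * ω univ := lintegral_const _
  calc energy κ ν = ∫⁻ x, potential κ ω x ∂ν := by
        rw [hbal.lintegral_eq hκ inferInstance hν]; rfl
    _ ≤ ∫⁻ _, C ∂ν := lintegral_mono_ae
        (Filter.mem_of_superset (mem_ae_iff.2 hν.2 : K ∈ ae ν) hC)
    _ = C * ν univ := lintegral_const _
    _ ≤ C * (M * ω univ) := by gcongr

/-- The measures swept onto compact subsets have increasing, uniformly bounded energies, and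
differences of energies are squared distances. They therefore converge along a suitable sequence of
compact sets. -/
theorem exists_balayage_of_bounded (hκ : IsAdmissibleKernel κ) (hA : StronglyClosedCone κ A)
    [IsFiniteMeasure ω]
    (husc : ∀ K : Set X, IsCompact K → K ⊆ A → UpperSemicontinuousOn (potential κ ω) K)
    {C : ℝ≥0} (hC : ∀ x ∈ A, potential κ ω x ≤ C) : ∃ ν, IsInnerBalayage κ A ω ν := by
  obtain ⟨M, -, hM⟩ := hκ.ugaheriPrinciple
  have hω : IsFiniteMeasureOnCompacts ω := inferInstance
  choose β hβ hβB using fun K : {K : Set X // IsCompact K ∧ K ⊆ A} =>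
    exists_balayage_of_isCompact hκ hM K.2.1 (husc K K.2.1 K.2.2) fun x hx => hC x (K.2.2 hx)
  set e : {K : Set X // IsCompact K ∧ K ⊆ A} → ℝ := fun K => realEnergy κ (β K) (β K) with he
  have hbdd : BddAbove (range e) := by
    refine ⟨(C * (M * ω univ) : ℝ≥0∞).toReal, ?_⟩
    rintro _ ⟨K, rfl⟩
    exact ENNReal.toReal_mono (by finiteness) (hβB K)
  -- Both swept measures have potential `U^ω` a.e. for `β K`, so `β L - β K` is orthogonal to `β K`,
  -- and Pythagoras applies.
  have hdist : ∀ K L : {K : Set X // IsCompact K ∧ K ⊆ A}, K.1 ⊆ L.1 →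
      sqDist κ (β K) (β L) = e L - e K := fun K L hKL => by
    have h1 : realEnergy κ (β K) (β L) = realEnergy κ (β K) (β K) := by
      rw [realEnergy, ← (hβ L).lintegral_eq hκ hω (EPosOn_mono hKL (hβ K).1),
        (hβ K).lintegral_eq hκ hω (hβ K).1, realEnergy]
    rw [sqDist, h1]
    simp only [he]
    ring
  have : Nonempty {K : Set X // IsCompact K ∧ K ⊆ A} := ⟨⟨∅, isCompact_empty, empty_subset _⟩⟩
  have hseq : ∀ n : ℕ, ∃ K, iSup e - 1 / ((n : ℝ) + 1) < e K := fun n =>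
    exists_lt_of_lt_ciSup (sub_lt_self _ Nat.one_div_pos_of_nat)
  choose K hKe using hseq
  -- Finite unions make the near-maximizing sets increasing; `β (T n)` is then close to `β L` for
  -- every compact `L ⊆ A` containing `T n`.
  let T : ℕ → {K : Set X // IsCompact K ∧ K ⊆ A} := fun n =>
    ⟨⋃ i ∈ Finset.range (n + 1), (K i).1, Finset.isCompact_biUnion _ fun i _ => (K i).2.1,
      iUnion₂_subset fun i _ => (K i).2.2⟩
  have hKT : ∀ n, (K n).1 ⊆ (T n).1 := fun n =>
    subset_biUnion_of_mem (u := fun i => (K i).1) (Finset.self_mem_range_succ n)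
  have hTmono : ∀ m n, m ≤ n → (T m).1 ⊆ (T n).1 := fun m n hmn =>
    biUnion_subset_biUnion_left fun i hi =>
      Finset.mem_coe.2 (Finset.range_mono (by lia) (Finset.mem_coe.1 hi))
  have hclose : ∀ n L, (T n).1 ⊆ L.1 → sqDist κ (β (T n)) (β L) ≤ 1 / ((n : ℝ) + 1) :=
    fun n L hL => by
      have h1 := sqDist_nonneg hκ (hβ (K n)).1.1 (hβ (T n)).1.1
      rw [hdist _ _ (hKT n)] at h1
      have h2 := hKe n
      have h3 : e L ≤ iSup e := le_ciSup hbdd L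
      rw [hdist _ _ hL]
      linarith
  have hlim0 := tendsto_one_div_add_atTop_nhds_zero_nat (𝕜 := ℝ)
  obtain ⟨ν, hν, hlim⟩ := exists_strongTendsto hκ (fun n => (hβ (T n)).1.1) hlim0
    fun m n hmn => hclose m _ (hTmono m n hmn)
  have hνA : ν ∈ EPosOn κ A := hA _ (fun n => EPosOn_mono (T n).2.2 (hβ (T n)).1) ν hν hlim
  have := hν.1
  refine ⟨ν, hνA, ?_⟩
  by_contra hn
  obtain ⟨τ, hτ, hτne⟩ := exists_of_not_nearlyEverywhereOn hn
  have : IsFiniteMeasure τ := ⟨by rw [hτ.2]; exact ENNReal.one_lt_top⟩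
  obtain ⟨L, hLA, hL, hLτ⟩ := exists_isCompact_measure_compl_lt hτ.1.2 one_ne_zero
  have hσL : τ.restrict L ∈ EPosOn κ L := by
    refine ⟨EPos_of_le hκ Measure.restrict_le_self hτ.1.1, ?_⟩
    rw [Measure.restrict_apply hL.measurableSet.compl]
    simp
  have hae : potential κ ν =ᵐ[τ.restrict L] potential κ ω := by
    refine ae_eq_of_forall_setLIntegral_eq_of_sigmaFinite (measurable_potential hκ ν)
      (measurable_potential hκ ω) fun s hs _ => ?_
    have hρ : (τ.restrict L).restrict s ∈ EPosOn κ L :=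
      EPosOn_of_le hκ Measure.restrict_le_self hσL
    set ρ := (τ.restrict L).restrict s
    -- `T n` need not contain `L`. Sweeping onto `T n ∪ L` yields the potential `U^ω` a.e. for
    -- measures on `L`, and the result differs from `β (T n)` by a quantity tending to zero.
    let TL : ℕ → {K : Set X // IsCompact K ∧ K ⊆ A} := fun n =>
      ⟨(T n).1 ∪ L, (T n).2.1.union hL, union_subset (T n).2.2 hLA⟩
    have h1 : ∀ n, ∫⁻ x, potential κ ω x ∂ρ = mutualEnergy κ ρ (β (TL n)) := fun n =>
      (hβ (TL n)).lintegral_eq hκ hω (EPosOn_mono subset_union_right hρ)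
    have h2 : Tendsto (fun n => realEnergy κ ρ (β (TL n)) - realEnergy κ ρ (β (T n))) atTop
        (𝓝 0) := by
      have h3 : Tendsto (fun n : ℕ => √(realEnergy κ ρ ρ) * √(1 / ((n : ℝ) + 1))) atTop (𝓝 0) := by
        simpa using (hlim0.sqrt).const_mul (√(realEnergy κ ρ ρ))
      refine squeeze_zero_norm (fun n => ?_) h3
      refine (abs_realEnergy_sub_le hκ hρ.1 (hβ (TL n)).1.1 (hβ (T n)).1.1).trans ?_
      rw [strongDist_eq_sqrt, sqDist_comm hκ (hβ (TL n)).1.1 (hβ (T n)).1.1]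
      gcongr
      exact hclose n (TL n) subset_union_left
    have h4 := StrongTendsto.realEnergy_left hκ (fun n => (hβ (T n)).1.1) hν hlim hρ.1
    have h5 := h2.add h4
    simp only [sub_add_cancel, zero_add] at h5
    have h6 : realEnergy κ ρ ν = (∫⁻ x, potential κ ω x ∂ρ).toReal := by
      refine tendsto_nhds_unique h5 (tendsto_const_nhds.congr fun n => ?_)
      rw [h1 n, realEnergy]
    rw [← mutualEnergy_eq_lintegral hκ, ← ENNReal.toReal_eq_toReal_iff'
      (mutualEnergy_lt_top hκ hρ.1 hν).ne
      (by rw [h1 0]; exact (mutualEnergy_lt_top hκ hρ.1 (hβ (TL 0)).1.1).ne)]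
    exact h6
  have hfalse : ∀ᵐ x ∂(τ.restrict L), False := by
    filter_upwards [hae, ae_restrict_of_ae hτne] with x h1 h2 using h2 h1
  rw [ae_iff] at hfalse
  have hL0 : τ L = 0 := by simpa using hfalse
  have : (1 : ℝ≥0∞) ≤ τ Lᶜ := by
    rw [← hτ.2, ← union_compl_self L]
    exact (measure_union_le _ _).trans (by rw [hL0, zero_add])
  exact this.not_gt hLτ

theorem existsUnique_balayage (hκ : IsAdmissibleKernel κ) (hA : StronglyClosedCone κ A)
    (hω : IsAdmissibleCharge κ A ω) : ∃! ν : Measure X, IsInnerBalayage κ A ω ν := by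
  obtain ⟨ν, hν⟩ : ∃ ν, IsInnerBalayage κ A ω ν := by
    rcases hω.finite_energy_or with h | ⟨h1, h2, h3⟩
    · exact exists_balayage_of_energy_lt_top hκ hA ⟨hω.radon, h⟩
    · have : IsFiniteMeasure ω := ⟨h1⟩
      refine exists_balayage_of_bounded hκ hA h2
        (C := (⨆ x ∈ A, potential κ ω x).toNNReal) fun x hx => ?_
      rw [ENNReal.coe_toNNReal h3.ne]
      exact le_iSup₂ (f := fun x (_ : x ∈ A) => potential κ ω x) x hx
  exact ⟨ν, hν, fun ν' hν' => hν'.unique hκ hω.radon hν⟩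

end Balayage

end InnerGauss

namespace InnerGauss

/-! ### Tightness and existence of minimizers of total mass one -/

section Minimizers

variable {X : Type*} [TopologicalSpace X] [T2Space X] [LocallyCompactSpace X]
    [SecondCountableTopology X] [MeasurableSpace X] [BorelSpace X] {κ : X → X → ℝ≥0∞}
    {A : Set X} {ω : Measure X}

theorem restrict_compl_mem_EPosOn_diff (hκ : IsAdmissibleKernel κ) {μ : Measure X}
    (hμ : μ ∈ EPosOn κ A) {K : Set X} (hK : MeasurableSet K) :
    μ.restrict Kᶜ ∈ EPosOn κ (A \ K) := by
  have h1 := EPosOn_of_le hκ (Measure.restrict_le_self (s := Kᶜ)) hμ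
  refine ⟨h1.1, ?_⟩
  have : (A \ K)ᶜ = Aᶜ ∪ K := by
    ext x
    simp [imp_iff_not_or]
  rw [this]
  refine measure_union_null h1.2 ?_
  rw [Measure.restrict_apply hK]
  simp

/-- If the inner capacity of `A` is finite, then the energies of unit measures concentrated on
`A` outside of large compact sets are arbitrarily large. -/
theorem exists_compactExhaustion_energy_ge (hκ : IsAdmissibleKernel κ) (hA : innerCap κ A < ∞)
    (𝒦 : CompactExhaustion X) (B : ℝ) :
    ∃ m, ∀ μ ∈ EPosUnit κ (A \ 𝒦 m), B ≤ realEnergy κ μ μ := by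
  by_contra! hcon
  let S : ℕ → Set (Measure X) := fun m => EPosUnit κ (A \ 𝒦 m)
  have hSmono : ∀ m n, m ≤ n → S n ⊆ S m := fun m n hmn =>
    EPosUnit_mono (sdiff_subset_sdiff_right (𝒦.subset hmn))
  let E : Measure X → ℝ := fun μ => realEnergy κ μ μ
  have hbb : ∀ m, BddBelow (E '' S m) := fun m =>
    ⟨0, by rintro _ ⟨μ, _, rfl⟩; exact realEnergy_nonneg _ _⟩
  have hne : ∀ m, (S m).Nonempty := fun m => (hcon m).imp fun _ h => h.1
  set d : ℕ → ℝ := fun m => sInf (E '' S m) with hd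
  have hdle : ∀ m, ∀ μ ∈ S m, d m ≤ E μ := fun m μ hμ => csInf_le (hbb m) ⟨μ, hμ, rfl⟩
  have hdmono : Monotone d := fun m n hmn =>
    csInf_le_csInf (hbb m) ((hne n).image E) (image_mono (hSmono m n hmn))
  have hdB : BddAbove (range d) := by
    refine ⟨B, ?_⟩
    rintro _ ⟨m, rfl⟩
    obtain ⟨μ, hμ, hμB⟩ := hcon m
    exact (hdle m μ hμ).trans hμB.le
  have hseq : ∀ m : ℕ, ∃ μ ∈ S m, E μ < d m + 1 / ((m : ℝ) + 1) := fun m => by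
    obtain ⟨_, ⟨μ, hμ, rfl⟩, h⟩ := exists_lt_of_csInf_lt ((hne m).image E)
      (lt_add_of_pos_right (d m) (Nat.one_div_pos_of_nat (n := m) (α := ℝ)))
    exact ⟨μ, hμ, h⟩
  choose μ hμ hμE using hseq
  have hlim0 := tendsto_one_div_add_atTop_nhds_zero_nat (𝕜 := ℝ)
  -- For `m ≤ n` the midpoint lies in `S m`, so the squared distance is at most `2 (d n - d m) +
  -- 2/(m+1) + 2/(n+1)`. It tends to zero because the infima `d` increase and are bounded.
  obtain ⟨ν, hν, hlim⟩ := exists_strongTendsto hκ (fun m => (hμ m).1.1)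
    (b := fun m => 2 * (iSup d - d m) + 4 * (1 / ((m : ℝ) + 1)))
    (by simpa using (((tendsto_atTop_ciSup hdmono hdB).const_sub (iSup d)).const_mul 2).add
          (hlim0.const_mul 4))
    (fun m n hmn => by
      have h1 := hdle m _ (midpointMeasure_mem_EPosUnit hκ (hμ m) (hSmono m n hmn (hμ n)))
      simp only [E] at h1
      rw [realEnergy_midpoint hκ (hμ m).1.1 (hμ n).1.1] at h1
      have h2 : realEnergy κ (μ m) (μ m) < d m + 1 / ((m : ℝ) + 1) := hμE m
      have h3 : realEnergy κ (μ n) (μ n) < d n + 1 / ((n : ℝ) + 1) := hμE n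
      have h4 : 1 / ((n : ℝ) + 1) ≤ 1 / ((m : ℝ) + 1) := Nat.one_div_le_one_div hmn
      have h5 : d n ≤ iSup d := le_ciSup hdB n
      linarith)
  -- The measures leave every compact set, so the vague limit vanishes; finite capacity keeps the
  -- energy of the strong limit positive, a contradiction.
  have hν0 : ν = 0 := by
    rw [← Measure.measure_univ_eq_zero]
    refine VagueTendsto.measure_eq_zero hν.1
      (StrongTendsto.vagueTendsto hκ (fun j => (hμ j).1.1) hν hlim) isOpen_univ fun K _ hK => ?_
    obtain ⟨n, hn⟩ := 𝒦.exists_superset_of_isCompact hK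
    filter_upwards [eventually_ge_atTop n] with j hj
    have hsub : interior K ⊆ (A \ 𝒦 j)ᶜ := fun x hx hxA =>
      hxA.2 (𝒦.subset hj (hn (interior_subset hx)))
    exact measure_mono_null hsub (hμ j).1.2
  obtain ⟨w, hw0, hw⟩ := exists_lower_bound_of_innerCap_lt_top hA
  have h1 : w ≤ realEnergy κ ν ν := ge_of_tendsto
    (StrongTendsto.realEnergy_self hκ (fun j => (hμ j).1.1) hν hlim)
    (Eventually.of_forall fun j => hw _ (EPosUnit_mono sdiff_subset (hμ j)))
  rw [hν0] at h1
  simp [realEnergy, mutualEnergy] at h1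
  exact h1.not_gt hw0

/-- If the inner capacity of `A` is finite, unit measures on `A` of bounded energy are
uniformly tight. -/
theorem exists_isCompact_measureReal_compl_le (hκ : IsAdmissibleKernel κ)
    (hA : innerCap κ A < ∞) {B ε : ℝ} (hB : 0 < B) (hε : 0 < ε) :
    ∃ K, IsCompact K ∧ ∀ μ ∈ EPosUnit κ A, realEnergy κ μ μ ≤ B → μ.real Kᶜ ≤ ε := by
  let 𝒦 : CompactExhaustion X := default
  -- With this threshold, mass `s` outside the compact set costs energy at least `B s²/ε²`; as the
  -- total is at most `B`, `s ≤ ε`.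
  obtain ⟨m, hm⟩ := exists_compactExhaustion_energy_ge hκ hA 𝒦 (B / ε ^ 2)
  refine ⟨𝒦 m, 𝒦.isCompact m, fun μ hμ hμB => ?_⟩
  have : IsFiniteMeasure μ := ⟨by rw [hμ.2]; exact ENNReal.one_lt_top⟩
  have h1 := mass_sq_mul_le hκ hm
    (restrict_compl_mem_EPosOn_diff hκ hμ.1 (𝒦.isCompact m).measurableSet) (measure_ne_top _ _)
  have h2 : realEnergy κ (μ.restrict (𝒦 m)ᶜ) (μ.restrict (𝒦 m)ᶜ) ≤ realEnergy κ μ μ :=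
    ENNReal.toReal_mono hμ.1.1.2.ne
      (mutualEnergy_mono hκ Measure.restrict_le_self Measure.restrict_le_self)
  rw [measureReal_restrict_apply_univ] at h1
  have h3 : B * (μ.real (𝒦 m)ᶜ) ^ 2 ≤ B * ε ^ 2 := by
    have := (h1.trans h2).trans hμB
    rw [div_mul_eq_mul_div, div_le_iff₀ (by positivity)] at this
    exact this
  exact (sq_le_sq₀ measureReal_nonneg hε.le).1 (le_of_mul_le_mul_left h3 hB)

/-- If the inner capacity of `A` is finite, the set of unit measures in `𝓔⁺(A)` is strongly
closed. -/
theorem EPosUnit_closed (hκ : IsAdmissibleKernel κ) (hAclosed : StronglyClosedCone κ A)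
    (hA : innerCap κ A < ∞) (μ : ℕ → Measure X) (hμ : ∀ j, μ j ∈ EPosUnit κ A)
    (μ₀ : Measure X) (h₀ : μ₀ ∈ EPos κ) (h : StrongTendsto κ μ atTop μ₀) :
    μ₀ ∈ EPosUnit κ A := by
  have hE : ∀ j, μ j ∈ EPos κ := fun j => (hμ j).1.1
  have hv := StrongTendsto.vagueTendsto hκ hE h₀ h
  have hle : μ₀ univ ≤ 1 := VagueTendsto.measure_univ_le h₀.1 hv fun j => (hμ j).2.le
  have hfin : IsFiniteMeasure μ₀ := ⟨hle.trans_lt ENNReal.one_lt_top⟩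
  have hfinj : ∀ j, IsFiniteMeasure (μ j) := fun j =>
    ⟨by rw [(hμ j).2]; exact ENNReal.one_lt_top⟩
  refine ⟨hAclosed μ (fun j => (hμ j).1) μ₀ h₀ h, le_antisymm hle ?_⟩
  obtain ⟨B, hB⟩ := (StrongTendsto.realEnergy_self hκ hE h₀ h).bddAbove_range
  have hB' : ∀ j, realEnergy κ (μ j) (μ j) ≤ max B 1 := fun j =>
    (hB ⟨j, rfl⟩).trans (le_max_left _ _)
  have hge : 1 ≤ μ₀.real univ := by
    refine le_of_forall_pos_le_add fun ε hε => ?_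
    obtain ⟨K, hK, hKε⟩ := exists_isCompact_measureReal_compl_le hκ hA
      (lt_max_of_lt_right one_pos : 0 < max B 1) hε
    have := VagueTendsto.le_measure_univ hfin hv hfinj hK (c := 1 - ε) fun j => by
      have h1 := hKε (μ j) (hμ j) (hB' j)
      have h2 := measureReal_add_measureReal_compl (μ := μ j) hK.measurableSet
      have h3 : (μ j).real univ = 1 := by rw [measureReal_def, (hμ j).2, ENNReal.toReal_one]
      linarith
    linarith
  rw [← ENNReal.toReal_le_toReal ENNReal.one_ne_top (measure_ne_top _ _), ENNReal.toReal_one]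
  exact hge

/-- The quadratic functional `‖μ‖² - 2 I(σ, μ)`. -/
noncomputable def quadEnergy (κ : X → X → ℝ≥0∞) (σ μ : Measure X) : ℝ :=
  realEnergy κ μ μ - 2 * realEnergy κ σ μ

theorem realEnergy_midpoint_right (hκ : IsAdmissibleKernel κ) {σ μ ν : Measure X}
    (hσ : σ ∈ EPos κ) (hμ : μ ∈ EPos κ) (hν : ν ∈ EPos κ) :
    realEnergy κ σ (midpointMeasure μ ν) = (realEnergy κ σ μ + realEnergy κ σ ν) / 2 := by
  rw [midpointMeasure, realEnergy_smul_right hκ (by norm_num) (EPos_add hκ hμ hν) hσ,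
    realEnergy_add_right hκ hμ hν hσ]
  ring

theorem exists_quadEnergy_minimizer (hκ : IsAdmissibleKernel κ) {S : Set (Measure X)}
    (hS : S ⊆ EPos κ) (hne : S.Nonempty) (hmid : ∀ μ ∈ S, ∀ ν ∈ S, midpointMeasure μ ν ∈ S)
    (hclosed : ∀ μ : ℕ → Measure X, (∀ j, μ j ∈ S) → ∀ μ₀ ∈ EPos κ,
      StrongTendsto κ μ atTop μ₀ → μ₀ ∈ S) {σ : Measure X} (hσ : σ ∈ EPos κ) :
    ∃ ν ∈ S, ∀ μ ∈ S, quadEnergy κ σ ν ≤ quadEnergy κ σ μ :=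
  exists_minimizer hκ hS hne hmid hclosed (realEnergy κ σ)
    (fun _ hμ _ hν => realEnergy_midpoint_right hκ hσ (hS hμ) (hS hν))
    (fun _ hμ _ h₀ h => StrongTendsto.realEnergy_left hκ (fun j => hS (hμ j)) (hS h₀) h hσ)
    ⟨-realEnergy κ σ σ, fun μ hμ => by
      have := sqDist_nonneg hκ hσ (hS hμ)
      unfold sqDist at this
      linarith⟩

theorem exists_minimizer_of_innerCap_lt_top (hκ : IsAdmissibleKernel κ)
    (hAclosed : StronglyClosedCone κ A) (hA0 : 0 < innerCap κ A) (hA : innerCap κ A < ∞)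
    {σ : Measure X} (hσ : σ ∈ EPos κ) :
    ∃ ν ∈ EPosUnit κ A, ∀ μ ∈ EPosUnit κ A, quadEnergy κ σ ν ≤ quadEnergy κ σ μ :=
  exists_quadEnergy_minimizer hκ (fun _ h => h.1.1) (innerCap_pos_iff.1 hA0)
    (fun _ hμ _ hν => midpointMeasure_mem_EPosUnit hκ hμ hν)
    (EPosUnit_closed hκ hAclosed hA) hσ

/-- The relaxed constraint, mass at most one, survives vague limits. A minimizer with mass below one
would satisfy the variational inequalities of the whole cone, which characterize `σ` itself. -/
theorem exists_minimizer_of_one_le_measure_univ (hκ : IsAdmissibleKernel κ)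
    (hAclosed : StronglyClosedCone κ A) {σ : Measure X} (hσ : σ ∈ EPosOn κ A)
    (h1 : 1 ≤ σ univ) :
    ∃ ν ∈ EPosUnit κ A, ∀ μ ∈ EPosUnit κ A, quadEnergy κ σ ν ≤ quadEnergy κ σ μ := by
  have hσE := hσ.1
  have := hσE.1
  obtain ⟨ν, hν, hmin⟩ := exists_quadEnergy_minimizer hκ (S := {μ | μ ∈ EPosOn κ A ∧ μ univ ≤ 1})
    (fun _ h => h.1.1) ⟨0, zero_mem_EPosOn, by simp⟩
    (fun _ hμ _ hν => ⟨midpointMeasure_mem_EPosOn hκ hμ.1 hν.1,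
      midpointMeasure_univ_le hμ.2 hν.2⟩)
    (fun μ hμ μ₀ h₀ h => ⟨hAclosed μ (fun j => (hμ j).1) μ₀ h₀ h,
      VagueTendsto.measure_univ_le h₀.1
        (StrongTendsto.vagueTendsto hκ (fun j => (hμ j).1.1) h₀ h) fun j => (hμ j).2⟩) hσE
  have hνE := hν.1.1
  have := hνE.1
  suffices hν1 : ν univ = 1 from
    ⟨ν, ⟨hν.1, hν1⟩, fun μ hμ => hmin μ ⟨hμ.1, hμ.2.le⟩⟩
  refine le_antisymm hν.2 (not_lt.1 fun hlt => ?_)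
  have hνfin : ν univ ≠ ∞ := (hlt.trans ENNReal.one_lt_top).ne
  have hνσ : realEnergy κ ν ν ≤ realEnergy κ σ ν := by
    refine realEnergy_le_of_variation hκ hνE fun t ht ht1 => ?_
    rw [← realEnergy_smul_right hκ (t := 1 - t) (by linarith) hνE hσE]
    refine hmin _ ⟨EPosOn_smul hκ hν.1 ENNReal.ofReal_ne_top, ?_⟩
    rw [Measure.smul_apply, smul_eq_mul]
    exact mul_le_one' (ENNReal.ofReal_le_one.2 (by linarith)) hν.2
  have hvar : ∀ ρ ∈ EPosOn κ A, ρ univ ≠ ∞ → realEnergy κ σ ρ ≤ realEnergy κ ν ρ := by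
    intro ρ hρ hρfin
    have hm0 : 0 ≤ (ρ univ).toReal := ENNReal.toReal_nonneg
    have hgap : 0 < 1 - (ν univ).toReal := by
      have := (ENNReal.toReal_lt_toReal hνfin ENNReal.one_ne_top).2 hlt
      rw [ENNReal.toReal_one] at this
      linarith
    -- `δ` is chosen so that the added mass `t ρ(X)` stays below the slack `1 - ν(X)`; the `+ 1`
    -- covers `ρ = 0`.
    refine le_realEnergy_of_variation hκ hνE hρ.1 (a := realEnergy κ σ ν)
      (δ := (1 - (ν univ).toReal) / ((ρ univ).toReal + 1)) (by positivity) fun t ht htδ => ?_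
    have hs : ENNReal.ofReal t • ρ ∈ EPosOn κ A := EPosOn_smul hκ hρ ENNReal.ofReal_ne_top
    rw [← realEnergy_smul_right hκ ht.le hρ.1 hσE, ← realEnergy_add_right hκ hνE hs.1 hσE]
    refine hmin _ ⟨EPosOn_add hκ hν.1 hs, ?_⟩
    have htm : ENNReal.ofReal t * ρ univ ≠ ∞ := ENNReal.mul_ne_top ENNReal.ofReal_ne_top hρfin
    rw [Measure.add_apply, Measure.smul_apply, smul_eq_mul,
      ← ENNReal.toReal_le_toReal (ENNReal.add_ne_top.2 ⟨hνfin, htm⟩) ENNReal.one_ne_top,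
      ENNReal.toReal_add hνfin htm, ENNReal.toReal_mul, ENNReal.toReal_ofReal ht.le,
      ENNReal.toReal_one]
    rw [lt_div_iff₀ (by positivity)] at htδ
    nlinarith
  -- `σ` may have infinite mass, so the inequality is first tested on its restrictions to compact
  -- sets and then passes to the limit by monotone convergence.
  have hσσ : mutualEnergy κ σ σ ≤ mutualEnergy κ σ ν := by
    have hdir : Directed (· ⊆ ·) (compactCovering X) :=
      directed_of_isDirected_le fun _ _ h => compactCovering_subset X h
    rw [mutualEnergy_eq_lintegral hκ σ σ, mutualEnergy_eq_lintegral hκ σ ν,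
      ← setLIntegral_univ, ← iUnion_compactCovering X, setLIntegral_iUnion_of_directed _ hdir]
    refine iSup_le fun n => ?_
    have hρ : σ.restrict (compactCovering X n) ∈ EPosOn κ A :=
      EPosOn_of_le hκ Measure.restrict_le_self hσ
    have h2 := hvar _ hρ (by
      rw [Measure.restrict_apply_univ]
      exact (isCompact_compactCovering X n).measure_lt_top.ne)
    rw [realEnergy_comm hκ hσE hρ.1, realEnergy_comm hκ hνE hρ.1] at h2
    have h3 := (ENNReal.toReal_le_toReal (mutualEnergy_lt_top hκ hρ.1 hσE).ne
      (mutualEnergy_lt_top hκ hρ.1 hνE).ne).1 h2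
    rw [← mutualEnergy_eq_lintegral hκ]
    refine h3.trans ?_
    rw [mutualEnergy_eq_lintegral hκ]
    exact setLIntegral_le_lintegral _ _
  have hσσ' : realEnergy κ σ σ ≤ realEnergy κ σ ν :=
    ENNReal.toReal_mono (mutualEnergy_lt_top hκ hσE hνE).ne hσσ
  have heq : σ = ν := eq_of_sqDist_le_zero hκ hσE hνE (by unfold sqDist; linarith)
  rw [← heq] at hlt
  exact hlt.not_ge h1

end Minimizers

/-! ### The Gauss functional and exhaustion by compact sets -/

section Gauss

variable {X : Type*} [TopologicalSpace X] [T2Space X] [LocallyCompactSpace X]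
    [SecondCountableTopology X] [MeasurableSpace X] [BorelSpace X] {κ : X → X → ℝ≥0∞}
    {A : Set X} {ω ωA : Measure X}

theorem IsInnerBalayage.integral_extField (hκ : IsAdmissibleKernel κ)
    (hω : IsFiniteMeasureOnCompacts ω) (h : IsInnerBalayage κ A ω ωA) {μ : Measure X}
    (hμ : μ ∈ EPosOn κ A) : Integrable (extField κ ω) μ ∧
      ∫ x, extField κ ω x ∂μ = -realEnergy κ ωA μ := by
  have hl := h.lintegral_eq hκ hω hμ
  have hfin : ∫⁻ x, potential κ ω x ∂μ ≠ ∞ := by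
    rw [hl]
    exact (mutualEnergy_lt_top hκ hμ.1 h.1.1).ne
  have hm := measurable_potential hκ ω
  refine ⟨(integrable_toReal_of_lintegral_ne_top hm.aemeasurable hfin).neg, ?_⟩
  unfold extField
  rw [integral_neg, integral_toReal hm.aemeasurable (ae_lt_top hm hfin), hl,
    realEnergy_comm hκ h.1.1 hμ.1, realEnergy]

theorem IsInnerBalayage.gaussFunctional_eq (hκ : IsAdmissibleKernel κ)
    (hω : IsFiniteMeasureOnCompacts ω) (h : IsInnerBalayage κ A ω ωA) {μ : Measure X}
    (hμ : μ ∈ EPosOn κ A) : gaussFunctional κ ω μ = quadEnergy κ ωA μ := by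
  rw [gaussFunctional, (h.integral_extField hκ hω hμ).2, quadEnergy, mul_neg, ← sub_eq_add_neg]
  rfl

theorem IsInnerBalayage.equilibriumConstant_eq (hκ : IsAdmissibleKernel κ)
    (hω : IsFiniteMeasureOnCompacts ω) (h : IsInnerBalayage κ A ω ωA) {μ : Measure X}
    (hμ : μ ∈ EPosOn κ A) :
    equilibriumConstant κ ω μ = realEnergy κ μ μ - realEnergy κ ωA μ := by
  have := hμ.1.1
  obtain ⟨h1, h2⟩ := h.integral_extField hκ hω hμ
  have hm := measurable_potential hκ μ
  have hfin : ∫⁻ x, potential κ μ x ∂μ ≠ ∞ := by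
    rw [← mutualEnergy_eq_lintegral hκ]
    exact hμ.1.2.ne
  unfold equilibriumConstant weightedPotential
  rw [integral_add (integrable_toReal_of_lintegral_ne_top hm.aemeasurable hfin) h1, h2,
    integral_toReal hm.aemeasurable (ae_lt_top hm hfin), ← mutualEnergy_eq_lintegral hκ,
    ← sub_eq_add_neg]
  rfl

theorem IsInnerBalayage.isGaussMinimizer_iff (hκ : IsAdmissibleKernel κ)
    (hω : IsFiniteMeasureOnCompacts ω) (h : IsInnerBalayage κ A ω ωA) {Q : Set X} (hQ : Q ⊆ A)
    {μ : Measure X} : IsGaussMinimizer κ ω Q μ ↔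
      μ ∈ EPosUnit κ Q ∧ ∀ ν ∈ EPosUnit κ Q, quadEnergy κ ωA μ ≤ quadEnergy κ ωA ν := by
  refine and_congr_right fun hμ => forall₂_congr fun ν hν => ?_
  rw [h.gaussFunctional_eq hκ hω (EPosOn_mono hQ hμ.1),
    h.gaussFunctional_eq hκ hω (EPosOn_mono hQ hν.1)]

theorem IsInnerBalayage.existsUnique_isGaussMinimizer (hκ : IsAdmissibleKernel κ)
    (hω : IsFiniteMeasureOnCompacts ω) (h : IsInnerBalayage κ A ω ωA) {Q : Set X} (hQ : Q ⊆ A)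
    (hex : ∃ ν ∈ EPosUnit κ Q, ∀ μ ∈ EPosUnit κ Q, quadEnergy κ ωA ν ≤ quadEnergy κ ωA μ) :
    ∃! ν : Measure X, IsGaussMinimizer κ ω Q ν := by
  obtain ⟨ν, hν⟩ := hex
  refine ⟨ν, (h.isGaussMinimizer_iff hκ hω hQ).2 hν, fun ν' hν' => ?_⟩
  have hν' := (h.isGaussMinimizer_iff hκ hω hQ).1 hν'
  exact minimizer_unique hκ (S := EPosUnit κ Q) (fun _ hμ => hμ.1.1)
    (fun _ hμ _ hμ' => midpointMeasure_mem_EPosUnit hκ hμ hμ') (realEnergy κ ωA)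
    (fun _ hμ _ hμ' => realEnergy_midpoint_right hκ h.1.1 hμ.1.1 hμ'.1.1) hν'.1 hν'.2 hν.1 hν.2

/-- Unit measures on `A` are approximated in energy by unit measures on compact subsets. -/
theorem exists_isCompact_quadEnergy_lt (hκ : IsAdmissibleKernel κ) {σ lam : Measure X}
    (hσ : σ ∈ EPos κ) (hlam : lam ∈ EPosUnit κ A) {ε : ℝ} (hε : 0 < ε) :
    ∃ K ⊆ A, IsCompact K ∧ ∃ μ ∈ EPosUnit κ K, quadEnergy κ σ μ < quadEnergy κ σ lam + ε := by
  have hprob : IsProbabilityMeasure lam := ⟨hlam.2⟩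
  have hlamE := hlam.1.1
  have := hσ.1
  choose K hKA hK hKlt using fun n : ℕ => exists_isCompact_measure_compl_lt (μ := lam) hlam.1.2
    (ε := ((n : ℝ≥0∞) + 2)⁻¹) (ENNReal.inv_ne_zero.2 (by finiteness))
  have hcompl : Tendsto (fun n => lam (K n)ᶜ) atTop (𝓝 0) := by
    refine tendsto_of_tendsto_of_tendsto_of_le_of_le tendsto_const_nhds
      ENNReal.tendsto_inv_nat_nhds_zero (fun _ => zero_le) fun n => (hKlt n).le.trans ?_
    exact ENNReal.inv_le_inv.2 le_self_add
  have hmass : Tendsto (fun n => lam.real (K n)) atTop (𝓝 1) := by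
    have h1 : ∀ n, lam.real (K n) = 1 - lam.real (K n)ᶜ := fun n => by
      rw [probReal_compl_eq_one_sub (hK n).measurableSet]
      ring
    simp only [h1, measureReal_def]
    simpa using ((ENNReal.tendsto_toReal ENNReal.zero_ne_top).comp hcompl).const_sub 1
  have hcross : Tendsto (fun n => realEnergy κ σ (lam.restrict (K n))) atTop
      (𝓝 (realEnergy κ σ lam)) := by
    have h1 : ∀ n, realEnergy κ σ (lam.restrict (K n)) = realEnergy κ σ lam -
        (∫⁻ x in (K n)ᶜ, potential κ σ x ∂lam).toReal := fun n => by
      have hr : ∀ s, lam.restrict s ∈ EPos κ := fun s =>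
        EPos_of_le hκ Measure.restrict_le_self hlamE
      have h2 := realEnergy_add_right hκ (hr (K n)) (hr (K n)ᶜ) hσ
      rw [Measure.restrict_add_restrict_compl (hK n).measurableSet,
        realEnergy_comm hκ hσ (hr (K n)ᶜ)] at h2
      rw [h2, ← mutualEnergy_eq_lintegral hκ]
      exact (add_sub_cancel_right _ _).symm
    simp only [h1]
    have h3 : Tendsto (fun n => ∫⁻ x in (K n)ᶜ, potential κ σ x ∂lam) atTop (𝓝 0) :=
      tendsto_setLIntegral_zero (by
        rw [← mutualEnergy_eq_lintegral hκ]
        exact (mutualEnergy_lt_top hκ hlamE hσ).ne) hcompl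
    simpa using ((ENNReal.tendsto_toReal ENNReal.zero_ne_top).comp h3).const_sub
      (realEnergy κ σ lam)
  -- In the energy term the restriction of `lam` is replaced by `lam` itself. This only enlarges the
  -- functional, so the limit of the cross term suffices.
  have hbound : Tendsto (fun n => (lam.real (K n))⁻¹ * ((lam.real (K n))⁻¹ * realEnergy κ lam lam)
      - 2 * ((lam.real (K n))⁻¹ * realEnergy κ σ (lam.restrict (K n)))) atTop
      (𝓝 (quadEnergy κ σ lam)) := by
    have hinv : Tendsto (fun n => (lam.real (K n))⁻¹) atTop (𝓝 1) := by
      simpa using hmass.inv₀ one_ne_zero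
    simpa [quadEnergy] using (hinv.mul (hinv.mul_const (realEnergy κ lam lam))).sub
      ((hinv.mul hcross).const_mul 2)
  obtain ⟨n, hn, hn0⟩ := ((hbound.eventually (gt_mem_nhds
    (lt_add_of_pos_right _ hε))).and (hmass.eventually (lt_mem_nhds one_pos))).exists
  have hr : lam.restrict (K n) ∈ EPosOn κ (K n) := by
    refine ⟨EPos_of_le hκ Measure.restrict_le_self hlamE, ?_⟩
    rw [Measure.restrict_apply (hK n).measurableSet.compl]
    simp
  have huniv : lam.restrict (K n) univ = ENNReal.ofReal (lam.real (K n)) := by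
    rw [Measure.restrict_apply_univ, measureReal_def, ENNReal.ofReal_toReal (measure_ne_top _ _)]
  have hi : 0 ≤ (lam.real (K n))⁻¹ := by positivity
  refine ⟨K n, hKA n, hK n, ENNReal.ofReal (lam.real (K n))⁻¹ • lam.restrict (K n), ?_,
    lt_of_le_of_lt ?_ hn⟩
  · rw [ENNReal.ofReal_inv_of_pos hn0, ← huniv]
    exact normalize_mem_EPosUnit hκ hr
      (by rw [huniv]; exact (ENNReal.ofReal_pos.2 hn0).ne') (measure_ne_top _ _)
  · rw [quadEnergy, realEnergy_smul_left hκ hi (EPos_smul hκ hr.1 ENNReal.ofReal_ne_top),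
      realEnergy_smul_right hκ hi hr.1 hr.1, realEnergy_smul_right hκ hi hr.1 hσ]
    gcongr
    exact ENNReal.toReal_mono hlamE.2.ne
      (mutualEnergy_mono hκ Measure.restrict_le_self Measure.restrict_le_self)

/-- The functional controls the distance to its minimizer. -/
theorem sqDist_le_of_minimizer (hκ : IsAdmissibleKernel κ) {σ lam μ : Measure X}
    (hσ : σ ∈ EPos κ) (hlam : lam ∈ EPosUnit κ A)
    (hmin : ∀ ν ∈ EPosUnit κ A, quadEnergy κ σ lam ≤ quadEnergy κ σ ν) (hμ : μ ∈ EPosUnit κ A) :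
    sqDist κ μ lam ≤ 2 * (quadEnergy κ σ μ - quadEnergy κ σ lam) := by
  have h1 := hmin _ (midpointMeasure_mem_EPosUnit hκ hμ hlam)
  unfold quadEnergy at h1 ⊢
  rw [realEnergy_midpoint hκ hμ.1.1 hlam.1.1,
    realEnergy_midpoint_right hκ hσ hμ.1.1 hlam.1.1] at h1
  linarith

theorem nonempty_compactIn (hκ : IsAdmissibleKernel κ) (hA : 0 < innerCap κ A) :
    Nonempty (CompactIn κ A) := by
  obtain ⟨lam, hlam⟩ := innerCap_pos_iff.1 hA
  -- With `σ = 0` the approximation serves only to produce a compact set carrying a unit measure of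
  -- finite energy.
  obtain ⟨K, hKA, hK, μ, hμ, -⟩ :=
    exists_isCompact_quadEnergy_lt hκ (zero_mem_EPos (κ := κ)) hlam one_pos
  exact ⟨⟨⟨K, hK⟩, hKA, innerCap_pos_iff.2 ⟨μ, hμ⟩⟩⟩

theorem isDirectedOrder_compactIn : IsDirectedOrder (CompactIn κ A) :=
  ⟨fun K L => ⟨⟨K.1 ⊔ L.1, by
    rw [Compacts.coe_sup]
    exact ⟨union_subset K.2.1 L.2.1, K.2.2.trans_le (innerCap_mono subset_union_left)⟩⟩,
    (le_sup_left : K.1 ≤ K.1 ⊔ L.1), (le_sup_right : L.1 ≤ K.1 ⊔ L.1)⟩⟩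

/-- A near-optimal unit measure on one compact `K` competes on every larger `L`, so `lam L` is
near-optimal on `A` and therefore close to `lamA`. The tolerance `ε / 2` absorbs the factor 2 in
`sqDist_le_of_minimizer`. -/
theorem strongTendsto_of_minimizers (hκ : IsAdmissibleKernel κ) {σ lamA : Measure X}
    (hσ : σ ∈ EPos κ) (hlamA : lamA ∈ EPosUnit κ A)
    (hminA : ∀ ν ∈ EPosUnit κ A, quadEnergy κ σ lamA ≤ quadEnergy κ σ ν)
    {lam : CompactIn κ A → Measure X} (hlam : ∀ K, lam K ∈ EPosUnit κ (K.1 : Set X))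
    (hmin : ∀ K, ∀ ν ∈ EPosUnit κ (K.1 : Set X), quadEnergy κ σ (lam K) ≤ quadEnergy κ σ ν) :
    StrongTendsto κ lam atTop lamA := by
  have hA : ∀ K, lam K ∈ EPosUnit κ A := fun K => EPosUnit_mono K.2.1 (hlam K)
  rw [strongTendsto_iff_sqDist hκ (fun K => (hA K).1.1) hlamA.1.1, Metric.tendsto_nhds]
  intro ε hε
  obtain ⟨K, hKA, hK, μ, hμ, hμε⟩ := exists_isCompact_quadEnergy_lt hκ hσ hlamA (half_pos hε)
  let K₀ : CompactIn κ A := ⟨⟨K, hK⟩, hKA, innerCap_pos_iff.2 ⟨μ, hμ⟩⟩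
  have := isDirectedOrder_compactIn (κ := κ) (A := A)
  have hne : Nonempty (CompactIn κ A) := ⟨K₀⟩
  filter_upwards [eventually_ge_atTop K₀] with L hL
  have hKL : K ⊆ (L.1 : Set X) := hL
  have h1 := hmin L μ (EPosUnit_mono hKL hμ)
  have h2 := sqDist_le_of_minimizer hκ hσ hlamA hminA (hA L)
  rw [Real.dist_eq, sub_zero, abs_of_nonneg (sqDist_nonneg hκ (hA L).1.1 hlamA.1.1)]
  linarith

end Gauss

end InnerGauss

/-! ### The main theorem -/

theorem mainTheorem6 {X : Type*} [TopologicalSpace X] [T2Space X] [LocallyCompactSpace X]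
    [SecondCountableTopology X] [MeasurableSpace X] [BorelSpace X]
    (κ : X → X → ℝ≥0∞) (hκ : IsAdmissibleKernel κ)
    (A : Set X) (hA : 0 < innerCap κ A) (hAclosed : StronglyClosedCone κ A)
    (ω : Measure X) (hω : IsAdmissibleCharge κ A ω) :
    -- the inner balayage of `ω` onto `A` is well defined
    (∃! ωA : Measure X, IsInnerBalayage κ A ω ωA) ∧
    ∀ ωA : Measure X, IsInnerBalayage κ A ω ωA →
      (innerCap κ A < ∞ ∨ ωA univ = 1 ∨ (FrostmanPrinciple κ ∧ 1 < ωA univ)) →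
      -- the minimizers are well defined
      (∃! lamA : Measure X, IsGaussMinimizer κ ω A lamA) ∧
      (∀ K : CompactIn κ A, ∃! lamK : Measure X, IsGaussMinimizer κ ω (K.1 : Set X) lamK) ∧
      -- the index set of the net is nonempty and upward directed
      Nonempty (CompactIn κ A) ∧ IsDirectedOrder (CompactIn κ A) ∧
      -- the convergence
      ∀ (lamA : Measure X) (lam : CompactIn κ A → Measure X),
        IsGaussMinimizer κ ω A lamA →
        (∀ K, IsGaussMinimizer κ ω (K.1 : Set X) (lam K)) →
        StrongTendsto κ lam atTop lamA ∧
        VagueTendsto lam atTop lamA ∧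
        Tendsto (fun K => equilibriumConstant κ ω (lam K)) atTop
          (𝓝 (equilibriumConstant κ ω lamA)) := by
  refine ⟨existsUnique_balayage hκ hAclosed hω, fun ωA hωA hcases => ?_⟩
  have hrad := hω.radon
  have hexA : ∃ ν ∈ EPosUnit κ A, ∀ μ ∈ EPosUnit κ A, quadEnergy κ ωA ν ≤ quadEnergy κ ωA μ := by
    rcases hcases with h | h | ⟨-, h⟩
    · exact exists_minimizer_of_innerCap_lt_top hκ hAclosed hA h hωA.1.1
    · exact exists_minimizer_of_one_le_measure_univ hκ hAclosed hωA.1 h.ge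
    · exact exists_minimizer_of_one_le_measure_univ hκ hAclosed hωA.1 h.le
  refine ⟨hωA.existsUnique_isGaussMinimizer hκ hrad Subset.rfl hexA, fun K => ?_,
    nonempty_compactIn hκ hA, isDirectedOrder_compactIn, fun lamA lam hlamA hlam => ?_⟩
  · exact hωA.existsUnique_isGaussMinimizer hκ hrad K.2.1
      (exists_minimizer_of_innerCap_lt_top hκ (stronglyClosedCone_of_isCompact hκ K.1.isCompact)
        K.2.2 (innerCap_lt_top_of_isCompact hκ K.1.isCompact) hωA.1.1)
  · obtain ⟨h1, h2⟩ := (hωA.isGaussMinimizer_iff hκ hrad Subset.rfl).1 hlamA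
    have h3 := fun K => (hωA.isGaussMinimizer_iff hκ hrad K.2.1).1 (hlam K)
    have hs := strongTendsto_of_minimizers hκ hωA.1.1 h1 h2 (fun K => (h3 K).1)
      fun K => (h3 K).2
    have hE : ∀ K, lam K ∈ EPosOn κ A := fun K => EPosOn_mono K.2.1 (h3 K).1.1
    refine ⟨hs, hs.vagueTendsto hκ (fun K => (hE K).1) h1.1.1, ?_⟩
    -- The constants equal `‖λ‖² - I(ω^A, λ)`, which is strongly continuous in `λ`.
    rw [hωA.equilibriumConstant_eq hκ hrad h1.1]
    simp only [hωA.equilibriumConstant_eq hκ hrad (hE _)]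
    exact (hs.realEnergy_self hκ (fun K => (hE K).1) h1.1.1).sub
      (hs.realEnergy_left hκ (fun K => (hE K).1) h1.1.1 hωA.1.1)
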